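/- **Setting.** Let $N,P\ge 1$, $M\ge 2$ be integers, $q\in\mathbb R$, and let $\mathcal A$ be a non-empty compact metric space. For $\alpha\in\mathcal A$ let $\sigma^\alpha:\mathbb R^N\to\mathbb R^{N\times P}$ (with columns $\sigma^\alpha_i$), $b^\alpha:\mathbb R^N\to\mathbb R^N$, $c^\alpha,f^\alpha:\mathbb R^N\to\mathbb R$, put $a^\alpha=\frac12\sigma^\alpha(\sigma^\alpha)^t$, and let $a,b,c,f$ be continuous on $\mathbb R^N\times\mathcal A$. Let $$F(x,t,p,X)=\sup_{\alpha}\{-\mathrm{tr}[a^\alpha(x)X]-b^\alpha(x)\cdot p+c^\alpha(x)t-f^\alpha(x)\}.$$ Write $|f|_0=\sup|f|$, $[f]_1$ for the best Lipschitz constant, $|f|_1=|f|_0+[f]_1$ (Euclidean and Frobenius norms); $C_b$ is the set of bounded continuous functions and $C^{0,1}$ the set of functions with $|f|_1<\infty$. Assume there are $\lambda>0$ and $K$ such that, for all $\alpha$, $c^\alpha\ge\lambda$, $|\sigma^\alpha|_1+|b^\alpha|_1+|f^\alpha|_1\le K$ and $|c^\alpha|_0\le K$. **Interpolation.** For $\Delta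 x>0$ divide $\mathbb R^N$ into the meshes $\prod_k[i_k\Delta x,(i_k+1)\Delta x]$, $i\in\mathbb Z^N$. The nodes of a mesh are the points with coordinates $\Delta x\,(i_k+\frac12(1+\xi_{j_k}))$, where $\xi_1,\dots,\xi_{M+1}$ are the Gauss–Lobatto–Legendre points ($\pm1$ and the zeros of the derivative of the $M$-th Legendre polynomial); $X_{\Delta x,M}$ is the set of all nodes. Choose, in any way, for every $x$ a closed mesh containing $x$; $\hat I_{\Delta x,M}v(x)$ is the value at $x$ of the tensorized Lagrange interpolant of $v$ on that mesh, truncated between the minimum and the maximum of $v$ over the nodes of that mesh. **Schemes.** Let $[\phi]_x(z)=\phi(x+z)$, $$\Pi(h,\alpha,y,\psi)=\frac1{2P}\sum_{i=1}^P\Big(\psi\big(hb^\alpha(y)+\sqrt{hP}\,\sigma_i^\alpha(y)\big)+\psi\big(hb^\alpha(y)-\sqrt{hP}\,\sigma_i^\alpha(y)\big)\Big),$$ $$\hat S(h,y,t,\psi)=\sup_\alpha\Big\{-\tfrac1h\big(\Pi(h,\alpha,y,\psi)-t\big)+c^\alpha(y)t-f^\alpha(y)\Big\},$$ $$\hat S'(h,y,t,\psi)=\sup_\alpha\Big\{-\tfrac1h\big((1-hc^\alpha(y))\Pi(h,\alpha,y,\psi)-t\big)-f^\alpha(y)\Big\},$$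 and let $S(h,x,t,[\phi]_x)=\hat S(h,x,t,[\hat I_{\Delta x,M}\phi]_x)$ and $S'(h,x,t,[\phi]_x)=\hat S'(h,x,t,[\hat I_{\Delta x,M}\phi]_x)$ with $\Delta x=h^q$. **Proposition.** The scheme $S$ has the following properties. 1. *($\varepsilon(q-1,K_1)$-monotonicity)* There are $K_1$ and $\bar\lambda>0$ such that for all $h>0$, $x\in\mathbb R^N$, $r\in\mathbb R$: (a) $S(h,x,r,[v]_x)\le S(h,x,r,[w]_x)+K_1|w|_1h^{q-1}$ if $v\ge w$, $v\in C_b$, $w\in C^{0,1}$; (b) $S(h,x,r,[v]_x)\le S(h,x,r,[w]_x)+K_1|v|_1h^{q-1}$ if $v\ge w$, $v\in C^{0,1}$, $w\in C_b$; (c) $S(h,x,r+m,[u+m]_x)\ge S(h,x,r,[u]_x)+\bar\lambda m$ if $m\ge0$, $u\in C_b$. 2. *(Regularity)* For all $h>0$ and $\phi\in C_b$, the function $x\mapsto S(h,x,\phi(x),[\phi]_x)$ is bounded on $\mathbb R^N$ and continuous on the grid $X_{\Delta x,M}$; it is continuous on all of $\mathbb R^N$ if $N=1$ or, more generally, if $\hat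 I_{\Delta x,M}\phi$ is continuous; and $r\mapsto S(h,x,r,[\phi]_x)$ is uniformly continuous for bounded $r$, uniformly in $x\in\mathbb R^N$. 3. *(Consistency with $k_2=\min(2q-1,1)$, $k_4=1$)* For every $h_0>0$ there is $K_2$ such that for all $h\in(0,h_0]$, $x\in\mathbb R^N$ and smooth $\phi$, $$|F(x,\phi(x),D\phi(x),D^2\phi(x))-S(h,x,\phi(x),[\phi]_x)|\le K_2\big(h^{\min(2q-1,1)}|D^2\phi|_0+h|D^4\phi|_0\big).$$ The scheme $S'$ has the same properties, except that property 1 is restricted to those $h>0$ with $hc^\alpha(x)\le1$ for all $\alpha,x$, and that the term $h|D\phi|_0$ (that is, $k_1=1$) is added inside the bracket in property 3. -/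

import Mathlib

open Set Topology
open scoped ENNReal ContDiff Matrix Matrix.Norms.Frobenius

noncomputable section

namespace HJB

/-- The space `ℝ^N` with its Euclidean norm. -/
abbrev E (N : ℕ) : Type := EuclideanSpace ℝ (Fin N)

/-! ### Norms.  Matrices carry the Frobenius norm; suprema are taken in `[0, ∞]`. -/

/-- `|f|_0 = sup_x |f x|`. -/
def supNorm {N : ℕ} {V : Type*} [NormedAddCommGroup V] (f : E N → V) : ℝ≥0∞ :=
  ⨆ x, ‖f x‖ₑ

/-- `[f]_1 = sup_{x ≠ y} |f x - f y| / |x - y|`. -/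
def lipSeminorm {N : ℕ} {V : Type*} [NormedAddCommGroup V] (f : E N → V) : ℝ≥0∞ :=
  ⨆ (x : E N) (y : E N) (_ : x ≠ y), ‖f x - f y‖ₑ / ‖x - y‖ₑ

/-- `|f|_1 = |f|_0 + [f]_1`. -/
def lipNorm {N : ℕ} {V : Type*} [NormedAddCommGroup V] (f : E N → V) : ℝ≥0∞ :=
  supNorm f + lipSeminorm f

/-- `φ ∈ C_b(ℝ^N)`: continuous and bounded. -/
def MemCb {N : ℕ} (φ : E N → ℝ) : Prop := Continuous φ ∧ supNorm φ < ⊤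

/-- `φ ∈ C^{0,1}(ℝ^N)`: finite norm `|φ|_1`. -/
def MemC01 {N : ℕ} (φ : E N → ℝ) : Prop := lipNorm φ < ⊤

/-! ### The Hamilton-Jacobi-Bellman operator -/

/-- The coefficients `σ^α, b^α, c^α, f^α`, for controls `α ∈ A`. -/
structure Coeffs (A : Type*) (N P : ℕ) where
  σ : A → E N → Matrix (Fin N) (Fin P) ℝ
  b : A → E N → E N
  c : A → E N → ℝ
  f : A → E N → ℝ

section Operator

variable {A : Type*} {N P : ℕ}

/-- `a^α = (1/2) σ^α (σ^α)ᵀ`. -/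
def Coeffs.a (D : Coeffs A N P) (α : A) (x : E N) : Matrix (Fin N) (Fin N) ℝ :=
  (1 / 2 : ℝ) • (D.σ α x * (D.σ α x)ᵀ)

/-- `a, b, c, f` are continuous on `ℝ^N × A`. -/
structure Coeffs.IsContinuous [TopologicalSpace A] (D : Coeffs A N P) : Prop where
  a : Continuous fun z : E N × A => D.a z.2 z.1
  b : Continuous fun z : E N × A => D.b z.2 z.1
  c : Continuous fun z : E N × A => D.c z.2 z.1
  f : Continuous fun z : E N × A => D.f z.2 z.1

/-- `c^α ≥ lam > 0`, `|σ^α|_1 + |b^α|_1 + |f^α|_1 ≤ K` and `|c^α|_0 ≤ K`, uniformly in `α`. -/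
structure Coeffs.Bounds (D : Coeffs A N P) (lam K : ℝ) : Prop where
  lam_pos : 0 < lam
  lam_le : ∀ α x, lam ≤ D.c α x
  norm_le : ∀ α, lipNorm (D.σ α) + lipNorm (D.b α) + lipNorm (D.f α) ≤ ENNReal.ofReal K
  c_le : ∀ α, supNorm (D.c α) ≤ ENNReal.ofReal K

/-- `F(x,t,p,X) = sup_α { -tr[a^α(x) X] - b^α(x)·p + c^α(x) t - f^α(x) }`. -/
def Coeffs.F (D : Coeffs A N P) (x : E N) (t : ℝ) (p : E N) (X : Matrix (Fin N) (Fin N) ℝ) : ℝ :=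
  ⨆ α, (-(D.a α x * X).trace - inner ℝ (D.b α x) p + D.c α x * t - D.f α x)

/-- The Hessian matrix of `φ` at `x`. -/
def hessian (φ : E N → ℝ) (x : E N) : Matrix (Fin N) (Fin N) ℝ :=
  Matrix.of fun i j =>
    iteratedFDeriv ℝ 2 φ x ![EuclideanSpace.single i 1, EuclideanSpace.single j 1]

end Operator

/-! ### Abstract schemes

A scheme is a map `S : ℝ → E N → ℝ → (E N → ℝ) → ℝ`; `S h x r φ` stands for
`S(h, x, r, [φ]_x)`.  The set `H` contains the values of the parameter `h` concerned. -/

section Abstract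

variable {N : ℕ}

/-- `ε(p,K)`-monotonicity of `S` for `h ∈ H`. -/
def EpsMonotone (H : Set ℝ) (p K : ℝ) (S : ℝ → E N → ℝ → (E N → ℝ) → ℝ) : Prop :=
  ∃ lamBar : ℝ, 0 < lamBar ∧
    (∀ h ∈ H, ∀ (x : E N) (r : ℝ) (w v : E N → ℝ), MemC01 w → MemCb v → w ≤ v →
      S h x r v ≤ S h x r w + K * (lipNorm w).toReal * h ^ p) ∧
    (∀ h ∈ H, ∀ (x : E N) (r : ℝ) (w v : E N → ℝ), MemCb w → MemC01 v → w ≤ v →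
      S h x r v ≤ S h x r w + K * (lipNorm v).toReal * h ^ p) ∧
    (∀ h ∈ H, ∀ (x : E N) (r m : ℝ) (u : E N → ℝ), 0 ≤ m → MemCb u →
      S h x r u + lamBar * m ≤ S h x (r + m) (fun z => u z + m))

/-- Regularity of `S`: for `h ∈ H` and `φ ∈ C_b`, the function `x ↦ S(h,x,φ(x),[φ]_x)` is bounded
on `ℝ^N` and continuous on `X h`, and `r ↦ S(h,x,r,[φ]_x)` is uniformly continuous for bounded `r`,
uniformly in `x ∈ ℝ^N`. -/
def Regular (H : Set ℝ) (X : ℝ → Set (E N)) (S : ℝ → E N → ℝ → (E N → ℝ) → ℝ) : Prop :=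
  ∀ h ∈ H, ∀ φ : E N → ℝ, MemCb φ →
    (∃ C : ℝ, ∀ x, |S h x (φ x) φ| ≤ C) ∧
    ContinuousOn (fun x => S h x (φ x) φ) (X h) ∧
    (∀ R : ℝ, ∀ ε > 0, ∃ δ > 0, ∀ (x : E N) (r s : ℝ), |r| ≤ R → |s| ≤ R → |r - s| < δ →
      |S h x r φ - S h x s φ| < ε)

/-- Consistency of `S` with the operator `F` for `h ∈ H`, with exponents `k i`, `i ∈ I`:
`|F(x,φ,Dφ,D²φ) - S(h,x,φ(x),[φ]_x)| ≤ K ∑_{i ∈ I} h^{k_i} |D^i φ|_0` for smooth `φ`. -/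
def Consistent (F : E N → ℝ → E N → Matrix (Fin N) (Fin N) ℝ → ℝ) (H : Set ℝ) (I : Finset ℕ)
    (k : ℕ → ℝ) (S : ℝ → E N → ℝ → (E N → ℝ) → ℝ) : Prop :=
  ∃ K : ℝ, ∀ h ∈ H, ∀ (x : E N) (φ : E N → ℝ), ContDiff ℝ ∞ φ →
    ‖F x (φ x) (gradient φ x) (hessian φ x) - S h x (φ x) φ‖ₑ ≤
      ENNReal.ofReal K * ∑ i ∈ I, ENNReal.ofReal (h ^ k i) * supNorm (iteratedFDeriv ℝ i φ)

end Abstract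

/-! ### Truncated Gauss-Lobatto-Legendre interpolation -/

section Interpolation

open Polynomial in
/-- Legendre polynomials: `L_0 = 1`, `L_1 = X`, `(n+2) L_{n+2} = (2n+3) X L_{n+1} - (n+1) L_n`. -/
def legendre : ℕ → Polynomial ℝ
  | 0 => 1
  | 1 => X
  | n + 2 => C ((n + 2 : ℝ)⁻¹) *
      (C (2 * n + 3 : ℝ) * X * legendre (n + 1) - C (n + 1 : ℝ) * legendre n)

open Classical in
/-- The Gauss-Lobatto-Legendre nodes: `-1`, `1` and the zeros of `L_M'` in `(-1,1)`. -/
def gllNodes (M : ℕ) : Finset ℝ :=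
  {-1, 1} ∪ (Polynomial.derivative (legendre M)).roots.toFinset.filter (fun s => -1 < s ∧ s < 1)

variable {N : ℕ}

/-- The tensor nodes `(ξ_{j_1}, …, ξ_{j_N})` of the reference cube `[-1,1]^N`. -/
def refNodes (N M : ℕ) : Finset (Fin N → ℝ) := Fintype.piFinset fun _ => gllNodes M

theorem refNodes_nonempty (N M : ℕ) : (refNodes N M).Nonempty := by
  refine ⟨fun _ => 1, ?_⟩
  simp [refNodes, gllNodes]

/-- The image in the mesh `∏_k [i_k δ, (i_k + 1) δ]` of the reference node `ξ`; its coordinates are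
`δ (i_k + (1 + ξ_k) / 2)`. -/
def gridPoint (δ : ℝ) (i : Fin N → ℤ) (ξ : Fin N → ℝ) : E N :=
  WithLp.toLp 2 fun k => δ * (i k + (1 + ξ k) / 2)

/-- The grid `X_{δ,M}` of all the nodes of all the meshes. -/
def grid (N : ℕ) (δ : ℝ) (M : ℕ) : Set (E N) :=
  {y | ∃ (i : Fin N → ℤ), ∃ ξ ∈ refNodes N M, y = gridPoint δ i ξ}

/-- `κ` selects for every `x` a closed mesh of size `δ` that contains `x`. -/
def IsMeshSelection (δ : ℝ) (κ : E N → Fin N → ℤ) : Prop :=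
  ∀ x k, (κ x k : ℝ) * δ ≤ x k ∧ x k ≤ ((κ x k : ℝ) + 1) * δ

/-- Tensorized Lagrange interpolation of `v` on the mesh `i`, evaluated at `x`.  The coordinates of
`x` rescaled to `[-1,1]` are `2 (x_k / δ - i_k) - 1`. -/
def meshInterp (δ : ℝ) (M : ℕ) (i : Fin N → ℤ) (v : E N → ℝ) (x : E N) : ℝ :=
  ∑ ξ ∈ refNodes N M, v (gridPoint δ i ξ) *
    ∏ k, (Lagrange.basis (gllNodes M) id (ξ k)).eval (2 * (x k / δ - i k) - 1)

/-- The truncated interpolator: the Lagrange interpolant on the mesh `κ x` of `x`, truncated between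
the minimum and the maximum of `v` over the nodes of that mesh. -/
def truncInterp (δ : ℝ) (M : ℕ) (κ : E N → Fin N → ℤ) (v : E N → ℝ) (x : E N) : ℝ :=
  max ((refNodes N M).inf' (refNodes_nonempty N M) fun ξ => v (gridPoint δ (κ x) ξ))
    (min (meshInterp δ M (κ x) v x)
      ((refNodes N M).sup' (refNodes_nonempty N M) fun ξ => v (gridPoint δ (κ x) ξ)))

end Interpolation

/-! ### Camilli-Falcone semi-Lagrangian schemes -/

section Schemes

variable {A : Type*} {N P : ℕ}

/-- `[φ]_x(z) = φ(x + z)`. -/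
def shift (φ : E N → ℝ) (x : E N) : E N → ℝ := fun z => φ (x + z)

/-- The `i`-th column of `σ^α(y)`. -/
def Coeffs.col (D : Coeffs A N P) (α : A) (y : E N) (i : Fin P) : E N :=
  WithLp.toLp 2 fun k => D.σ α y k i

/-- `(1/2P) ∑_i ( ψ(h b^α(y) + √(hP) σ_i^α(y)) + ψ(h b^α(y) - √(hP) σ_i^α(y)) )`. -/
def Coeffs.average (D : Coeffs A N P) (h : ℝ) (α : A) (y : E N) (ψ : E N → ℝ) : ℝ :=
  1 / (2 * P) * ∑ i : Fin P,
    (ψ (h • D.b α y + √(h * P) • D.col α y i) + ψ (h • D.b α y - √(h * P) • D.col α y i))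

/-- The semi-Lagrangian operator whose zero-order term is `c^α(y) t`. -/
def Coeffs.hatS (D : Coeffs A N P) (h : ℝ) (y : E N) (t : ℝ) (ψ : E N → ℝ) : ℝ :=
  ⨆ α, (-(1 / h) * (D.average h α y ψ - t) + D.c α y * t - D.f α y)

/-- The semi-Lagrangian operator whose zero-order term is the discount factor `1 - h c^α(y)`. -/
def Coeffs.hatSDisc (D : Coeffs A N P) (h : ℝ) (y : E N) (t : ℝ) (ψ : E N → ℝ) : ℝ :=
  ⨆ α, (-(1 / h) * ((1 - h * D.c α y) * D.average h α y ψ - t) - D.f α y)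

/-- The scheme `S(h,x,t,[φ]_x) = Ŝ(h,x,t,[Î_{Δx,M} φ]_x)` with `Δx = h^q`; `κ δ` selects the mesh
of size `δ` of a point. -/
def Coeffs.scheme (D : Coeffs A N P) (M : ℕ) (q : ℝ) (κ : ℝ → E N → Fin N → ℤ)
    (h : ℝ) (x : E N) (t : ℝ) (φ : E N → ℝ) : ℝ :=
  D.hatS h x t (shift (truncInterp (h ^ q) M (κ (h ^ q)) φ) x)

/-- The same scheme, built on the operator with the discount factor. -/
def Coeffs.schemeDisc (D : Coeffs A N P) (M : ℕ) (q : ℝ) (κ : ℝ → E N → Fin N → ℤ)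
    (h : ℝ) (x : E N) (t : ℝ) (φ : E N → ℝ) : ℝ :=
  D.hatSDisc h x t (shift (truncInterp (h ^ q) M (κ (h ^ q)) φ) x)

end Schemes

end HJB

end

namespace HJB

/-! ### Gauss-Lobatto-Legendre nodes and Lagrange bases -/

section Nodes

variable {N M : ℕ}

/-! Both schemes are endpoints, θ = 0 and θ = 1, of one family `Coeffs.blend` in which a share θ of
the zero-order term acts as a discount factor. Everything is proved once for the family. Passing to
suprema over controls does not enlarge uniform errors (`ciSup_le_ciSup_add`, `abs_ciSup_sub_le`), so
it is enough to estimate `Coeffs.blendTerm` with constants independent of α.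

Monotonicity: truncation keeps the interpolant between its nodal extremes, and on one mesh the nodal
values of an L-Lipschitz function differ by at most L√N Δx. So order survives interpolation up to
L√N Δx (`meshTrunc_le_add`). The average has nonnegative weights of sum 1, and division by h turns
the error into √N L h^(q-1).

Regularity: the grid is locally finite, so continuity on it is automatic. When the interpolant is
continuous, the terms vary continuously in x uniformly in α: σ, b, f by their Lipschitz bounds, c by
compactness of the control set. On the line, neighbouring meshes meet in a common node, so the
pieces of the interpolant glue.

Consistency: the interpolation error is O(Δx² |D²φ|). Affine exactness and the finite Lebesgue
constant handle the interpolant; the truncation levels are harmless because an affine function on a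
cube is extremal at vertices, which are nodes (`exists_meshTrunc_error`). Division by h gives
h^(2q-1). The average of φ itself is a weak Euler step: symmetric differences cancel odd orders, and
the mixed drift-diffusion term, of third order, is absorbed into orders 2 and 4 by Landau's
inequality. Discounting multiplies c by the average instead of φ(x); their difference is O(h) and
brings in |Dφ|. -/

theorem neg_one_mem_gllNodes (M : ℕ) : (-1 : ℝ) ∈ gllNodes M := by simp [gllNodes]

theorem one_mem_gllNodes (M : ℕ) : (1 : ℝ) ∈ gllNodes M := by simp [gllNodes]

theorem mem_Icc_of_mem_gllNodes {s : ℝ} (hs : s ∈ gllNodes M) : s ∈ Icc (-1 : ℝ) 1 := by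
  simp only [gllNodes, Finset.mem_union, Finset.mem_insert, Finset.mem_singleton,
    Finset.mem_filter] at hs
  rcases hs with (rfl | rfl) | ⟨-, h1, h2⟩
  · norm_num
  · norm_num
  · exact ⟨h1.le, h2.le⟩

theorem one_lt_card_gllNodes (M : ℕ) : 1 < (gllNodes M).card :=
  Finset.one_lt_card.2 ⟨-1, neg_one_mem_gllNodes M, 1, one_mem_gllNodes M, by norm_num⟩

theorem mem_refNodes {ξ : Fin N → ℝ} : ξ ∈ refNodes N M ↔ ∀ k, ξ k ∈ gllNodes M :=
  Fintype.mem_piFinset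

/-- The one-dimensional Lagrange basis polynomial of the node `s`, evaluated at `t`. -/
noncomputable def gllBasis (M : ℕ) (s t : ℝ) : ℝ := (Lagrange.basis (gllNodes M) id s).eval t

theorem sum_gllBasis (M : ℕ) (t : ℝ) : ∑ s ∈ gllNodes M, gllBasis M s t = 1 := by
  have h := Lagrange.sum_basis (s := gllNodes M) (v := id) (injOn_id _)
    ⟨1, one_mem_gllNodes M⟩
  simpa [gllBasis, Polynomial.eval_finsetSum] using congrArg (Polynomial.eval t) h

/-- The identity polynomial has degree 1, and the two endpoints already give more than one node, so
it is its own interpolant. -/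
theorem sum_mul_gllBasis (M : ℕ) (t : ℝ) : ∑ s ∈ gllNodes M, s * gllBasis M s t = t := by
  have h := Lagrange.eq_interpolate (s := gllNodes M) (v := id) (f := Polynomial.X) (injOn_id _)
    (by rw [Polynomial.degree_X]; exact_mod_cast one_lt_card_gllNodes M)
  have h2 := congrArg (Polynomial.eval t) h
  simp only [Lagrange.interpolate_apply, Polynomial.eval_finsetSum, Polynomial.eval_X,
    Polynomial.eval_mul, Polynomial.eval_C, id] at h2
  exact h2.symm

theorem sum_refNodes_prod (f : Fin N → ℝ → ℝ) :
    ∑ ξ ∈ refNodes N M, ∏ k, f k (ξ k) = ∏ k, ∑ s ∈ gllNodes M, f k s :=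
  (Finset.prod_univ_sum (fun _ : Fin N => gllNodes M) f).symm

theorem sum_prod_gllBasis (t : Fin N → ℝ) :
    ∑ ξ ∈ refNodes N M, ∏ k, gllBasis M (ξ k) (t k) = 1 := by
  rw [sum_refNodes_prod fun k s => gllBasis M s (t k)]
  simp [sum_gllBasis]

/-- The coordinate weight is absorbed into the `j`-th factor of the tensor product; every other
factor sums to 1. -/
theorem sum_coord_mul_prod_gllBasis (t : Fin N → ℝ) (j : Fin N) :
    ∑ ξ ∈ refNodes N M, ξ j * ∏ k, gllBasis M (ξ k) (t k) = t j := by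
  have h := sum_refNodes_prod (M := M)
    fun (k : Fin N) s => (if k = j then s else 1) * gllBasis M s (t k)
  simp only [Finset.prod_mul_distrib, Finset.prod_ite_eq', Finset.mem_univ, if_true] at h
  rw [h, Finset.prod_eq_single j]
  · simp [sum_mul_gllBasis]
  · intro k _ hk
    simp [hk, sum_gllBasis]
  · simp

theorem prod_gllBasis_self {ξ η : Fin N → ℝ} (hξ : ξ ∈ refNodes N M) :
    ∏ k, gllBasis M (η k) (ξ k) = if η = ξ then 1 else 0 := by
  rw [mem_refNodes] at hξ
  split_ifs with h
  · subst h
    refine Finset.prod_eq_one fun k _ => ?_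
    exact Lagrange.eval_basis_self (v := id) (injOn_id _) (hξ k)
  · obtain ⟨k, hk⟩ := Function.ne_iff.1 h
    refine Finset.prod_eq_zero (Finset.mem_univ k) ?_
    exact Lagrange.eval_basis_of_ne (v := id) hk (hξ k)

/-- The Lebesgue constant of the tensorized interpolation is finite. -/
theorem exists_lebesgue_bound (N M : ℕ) : ∃ C : ℝ, 1 ≤ C ∧ ∀ t : Fin N → ℝ,
    (∀ k, t k ∈ Icc (-1 : ℝ) 1) → ∑ ξ ∈ refNodes N M, |∏ k, gllBasis M (ξ k) (t k)| ≤ C := by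
  have hc : Continuous fun t : Fin N → ℝ => ∑ ξ ∈ refNodes N M, |∏ k, gllBasis M (ξ k) (t k)| := by
    unfold gllBasis
    fun_prop
  obtain ⟨C, hC⟩ := (isCompact_univ_pi fun _ : Fin N => isCompact_Icc (a := (-1 : ℝ))
    (b := 1)).bddAbove_image hc.continuousOn
  -- The lower bound 1 lets the same constant dominate the truncation error, which is at most `e`
  -- itself.
  refine ⟨max C 1, le_max_right _ _, fun t ht => le_max_of_le_left ?_⟩
  exact hC ⟨t, fun k _ => ht k, rfl⟩

end Nodes

/-! ### Interpolation on one mesh -/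

section Mesh

variable {N M : ℕ} {δ : ℝ}

/-- The interpolant on the mesh `i`, truncated between the extremal values at the nodes. -/
noncomputable def meshTrunc (δ : ℝ) (M : ℕ) (i : Fin N → ℤ) (v : E N → ℝ) (x : E N) : ℝ :=
  max ((refNodes N M).inf' (refNodes_nonempty N M) fun ξ => v (gridPoint δ i ξ))
    (min (meshInterp δ M i v x)
      ((refNodes N M).sup' (refNodes_nonempty N M) fun ξ => v (gridPoint δ i ξ)))

theorem truncInterp_eq_meshTrunc (κ : E N → Fin N → ℤ) (v : E N → ℝ) (x : E N) :
    truncInterp δ M κ v x = meshTrunc δ M (κ x) v x := rfl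

theorem meshInterp_eq (i : Fin N → ℤ) (v : E N → ℝ) (x : E N) :
    meshInterp δ M i v x = ∑ ξ ∈ refNodes N M, v (gridPoint δ i ξ) *
      ∏ k, gllBasis M (ξ k) (2 * (x k / δ - i k) - 1) := rfl

theorem meshInterp_add_const (i : Fin N → ℤ) (v : E N → ℝ) (m : ℝ) (x : E N) :
    meshInterp δ M i (fun z => v z + m) x = meshInterp δ M i v x + m := by
  simp only [meshInterp_eq, add_mul, Finset.sum_add_distrib, ← Finset.mul_sum]
  rw [sum_prod_gllBasis]
  simp

/-- Interpolation is exact on affine functions. -/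
theorem meshInterp_affine (hδ : δ ≠ 0) (i : Fin N → ℤ) (c : ℝ) (a : Fin N → ℝ) (w x : E N) :
    meshInterp δ M i (fun y => c + ∑ k, a k * (y k - w k)) x = c + ∑ k, a k * (x k - w k) := by
  have key : ∀ k, ∑ ξ ∈ refNodes N M, (gridPoint δ i ξ k - w k) *
      ∏ l, gllBasis M (ξ l) (2 * (x l / δ - i l) - 1) = x k - w k := by
    intro k
    have h1 := sum_coord_mul_prod_gllBasis (M := M) (fun l => 2 * (x l / δ - i l) - 1) k
    have h2 := sum_prod_gllBasis (M := M) (fun l => 2 * (x l / δ - i l) - 1)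
    have : ∀ ξ : Fin N → ℝ, (gridPoint δ i ξ k - w k) *
        ∏ l, gllBasis M (ξ l) (2 * (x l / δ - i l) - 1) =
        δ / 2 * (ξ k * ∏ l, gllBasis M (ξ l) (2 * (x l / δ - i l) - 1)) +
        (δ * (i k + 1 / 2) - w k) * ∏ l, gllBasis M (ξ l) (2 * (x l / δ - i l) - 1) := by
      intro ξ
      simp only [gridPoint]
      ring
    simp only [this, Finset.sum_add_distrib, ← Finset.mul_sum, h1, h2]
    field_simp
    ring
  simp only [meshInterp_eq, add_mul, Finset.sum_add_distrib, ← Finset.mul_sum, sum_prod_gllBasis,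
    Finset.sum_mul]
  rw [Finset.sum_comm, mul_one]
  congr 1
  refine Finset.sum_congr rfl fun k _ => ?_
  simp only [mul_assoc, ← Finset.mul_sum, key]

theorem exists_le_meshTrunc (i : Fin N → ℤ) (v : E N → ℝ) (x : E N) :
    ∃ ξ ∈ refNodes N M, v (gridPoint δ i ξ) ≤ meshTrunc δ M i v x := by
  obtain ⟨ξ, hξ, h⟩ := Finset.exists_mem_eq_inf' (refNodes_nonempty N M)
    fun ξ => v (gridPoint δ i ξ)
  exact ⟨ξ, hξ, h ▸ le_max_left _ _⟩

theorem exists_meshTrunc_le (i : Fin N → ℤ) (v : E N → ℝ) (x : E N) :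
    ∃ ξ ∈ refNodes N M, meshTrunc δ M i v x ≤ v (gridPoint δ i ξ) := by
  obtain ⟨ξ, hξ, h⟩ := Finset.exists_mem_eq_sup' (refNodes_nonempty N M)
    fun ξ => v (gridPoint δ i ξ)
  refine ⟨ξ, hξ, max_le ((Finset.inf'_le _ hξ)) ((min_le_right _ _).trans h.le)⟩

/-- Interpolation reproduces constants, and `min` and `max` commute with translations. -/
theorem meshTrunc_add_const (i : Fin N → ℤ) (v : E N → ℝ) (m : ℝ) (x : E N) :
    meshTrunc δ M i (fun z => v z + m) x = meshTrunc δ M i v x + m := by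
  have h1 : ((refNodes N M).inf' (refNodes_nonempty N M) fun ξ => v (gridPoint δ i ξ) + m) =
      ((refNodes N M).inf' (refNodes_nonempty N M) fun ξ => v (gridPoint δ i ξ)) + m :=
    (Finset.apply_inf'_eq_inf'_comp (refNodes_nonempty N M) (fun y => y + m)
      fun y z => (min_add_add_right y z m).symm).symm
  have h2 : ((refNodes N M).sup' (refNodes_nonempty N M) fun ξ => v (gridPoint δ i ξ) + m) =
      ((refNodes N M).sup' (refNodes_nonempty N M) fun ξ => v (gridPoint δ i ξ)) + m :=
    (Finset.apply_sup'_eq_sup'_comp (refNodes_nonempty N M) (fun y => y + m)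
      fun y z => (max_add_add_right y z m).symm).symm
  unfold meshTrunc
  rw [meshInterp_add_const, h1, h2, min_add_add_right, max_add_add_right]

/-- The interpolant is exact at a node, and a nodal value lies between the truncation levels, so
truncation does nothing there. -/
theorem meshTrunc_gridPoint (hδ : δ ≠ 0) (i : Fin N → ℤ) (v : E N → ℝ) {ξ : Fin N → ℝ}
    (hξ : ξ ∈ refNodes N M) : meshTrunc δ M i v (gridPoint δ i ξ) = v (gridPoint δ i ξ) := by
  have h : meshInterp δ M i v (gridPoint δ i ξ) = v (gridPoint δ i ξ) := by
    have : ∀ k, 2 * ((gridPoint δ i ξ) k / δ - i k) - 1 = ξ k := by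
      intro k
      simp only [gridPoint]
      field_simp
      ring
    simp only [meshInterp_eq, this, prod_gllBasis_self hξ]
    simp [hξ]
  unfold meshTrunc
  rw [h, min_eq_left (Finset.le_sup' (fun ξ => v (gridPoint δ i ξ)) hξ),
    max_eq_right (Finset.inf'_le (fun ξ => v (gridPoint δ i ξ)) hξ)]

theorem continuous_meshTrunc (i : Fin N → ℤ) (v : E N → ℝ) :
    Continuous (meshTrunc δ M i v) := by
  unfold meshTrunc meshInterp
  fun_prop

theorem gridPoint_mem_mesh (hδ : 0 < δ) (i : Fin N → ℤ) {ξ : Fin N → ℝ}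
    (hξ : ξ ∈ refNodes N M) (k : Fin N) :
    (i k : ℝ) * δ ≤ gridPoint δ i ξ k ∧ gridPoint δ i ξ k ≤ ((i k : ℝ) + 1) * δ := by
  have h := mem_Icc_of_mem_gllNodes (mem_refNodes.1 hξ k)
  simp only [gridPoint]
  constructor <;> nlinarith [h.1, h.2]

theorem dist_le_of_mem_mesh (hδ : 0 ≤ δ) {i : Fin N → ℤ} {x y : E N}
    (hx : ∀ k, (i k : ℝ) * δ ≤ x k ∧ x k ≤ ((i k : ℝ) + 1) * δ)
    (hy : ∀ k, (i k : ℝ) * δ ≤ y k ∧ y k ≤ ((i k : ℝ) + 1) * δ) : ‖x - y‖ ≤ √N * δ := by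
  rw [EuclideanSpace.norm_eq]
  have : ∑ k, ‖(x - y) k‖ ^ 2 ≤ N * δ ^ 2 := by
    calc ∑ k, ‖(x - y) k‖ ^ 2 ≤ ∑ _k : Fin N, δ ^ 2 := by
          refine Finset.sum_le_sum fun k _ => ?_
          refine pow_le_pow_left₀ (norm_nonneg _) ?_ 2
          rw [Real.norm_eq_abs, PiLp.sub_apply, abs_le]
          constructor <;> linarith [(hx k).1, (hx k).2, (hy k).1, (hy k).2]
      _ = N * δ ^ 2 := by simp
  calc √(∑ k, ‖(x - y) k‖ ^ 2) ≤ √(N * δ ^ 2) := Real.sqrt_le_sqrt this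
    _ = √N * δ := by rw [Real.sqrt_mul (Nat.cast_nonneg N), Real.sqrt_sq hδ]

/-- Truncated interpolation is monotone up to the oscillation of the functions over a mesh. -/
theorem meshTrunc_le_add (hδ : 0 < δ) (i : Fin N → ℤ) {v w : E N → ℝ} {L : ℝ} (hL : 0 ≤ L)
    (hwv : w ≤ v)
    (hlip : (∀ y z, |w y - w z| ≤ L * ‖y - z‖) ∨ (∀ y z, |v y - v z| ≤ L * ‖y - z‖)) (x : E N) :
    meshTrunc δ M i w x ≤ meshTrunc δ M i v x + L * (√N * δ) := by
  obtain ⟨ξ, hξ, h1⟩ := exists_meshTrunc_le (δ := δ) (M := M) i w x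
  obtain ⟨η, hη, h2⟩ := exists_le_meshTrunc (δ := δ) (M := M) i v x
  have hd : L * ‖gridPoint δ i ξ - gridPoint δ i η‖ ≤ L * (√N * δ) :=
    mul_le_mul_of_nonneg_left (dist_le_of_mem_mesh hδ.le (gridPoint_mem_mesh hδ i hξ)
      (gridPoint_mem_mesh hδ i hη)) hL
  -- The node change from `ξ` to `η` is made with whichever function is Lipschitz, and `w ≤ v` is
  -- used at the other end: at `η` if it is `w`, at `ξ` if it is `v`.
  rcases hlip with h | h
  · linarith [le_abs_self (w (gridPoint δ i ξ) - w (gridPoint δ i η)), hwv (gridPoint δ i η),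
      h (gridPoint δ i ξ) (gridPoint δ i η)]
  · linarith [le_abs_self (v (gridPoint δ i ξ) - v (gridPoint δ i η)), hwv (gridPoint δ i ξ),
      h (gridPoint δ i ξ) (gridPoint δ i η)]

/-- The interpolation error is controlled by the distance to an affine function at the nodes. -/
theorem exists_meshTrunc_error (N M : ℕ) : ∃ C : ℝ, 1 ≤ C ∧
    ∀ (δ : ℝ) (i : Fin N → ℤ) (v : E N → ℝ) (x : E N) (a : Fin N → ℝ) (e : ℝ), 0 < δ →
    (∀ k, (i k : ℝ) * δ ≤ x k ∧ x k ≤ ((i k : ℝ) + 1) * δ) →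
    (∀ ξ ∈ refNodes N M, |v (gridPoint δ i ξ) - (v x + ∑ k, a k * (gridPoint δ i ξ k - x k))| ≤ e) →
    |meshTrunc δ M i v x - v x| ≤ C * e := by
  obtain ⟨C, hC1, hC⟩ := exists_lebesgue_bound N M
  refine ⟨C, hC1, fun δ i v x a e hδ hx he => ?_⟩
  have he0 : 0 ≤ e := by
    obtain ⟨ξ, hξ⟩ := refNodes_nonempty N M
    exact (abs_nonneg _).trans (he ξ hξ)
  have heC : e ≤ C * e := le_mul_of_one_le_left he0 hC1
  have hint : |meshInterp δ M i v x - v x| ≤ C * e := by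
    -- The affine comparison function equals `v x` at `x`, and so does its interpolant; what remains
    -- is the interpolant of the nodal deviations, controlled by the Lebesgue constant.
    have h1 := meshInterp_affine (M := M) hδ.ne' i (v x) a x x
    simp only [sub_self, mul_zero, Finset.sum_const_zero, add_zero] at h1
    conv_lhs => rw [← h1]
    simp only [meshInterp_eq]
    rw [← Finset.sum_sub_distrib]
    simp only [← sub_mul]
    refine (Finset.abs_sum_le_sum_abs _ _).trans ?_
    have ht := hC (fun k => 2 * (x k / δ - i k) - 1) fun k => by
      have h1 : (i k : ℝ) ≤ x k / δ := (le_div_iff₀ hδ).2 (hx k).1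
      have h2 : x k / δ ≤ i k + 1 := (div_le_iff₀ hδ).2 (hx k).2
      constructor <;> linarith
    calc _ ≤ ∑ ξ ∈ refNodes N M, e * |∏ k, gllBasis M (ξ k) (2 * (x k / δ - i k) - 1)| := by
          refine Finset.sum_le_sum fun ξ hξ => ?_
          rw [abs_mul]
          exact mul_le_mul_of_nonneg_right (he ξ hξ) (abs_nonneg _)
      _ ≤ C * e := by
          rw [← Finset.mul_sum, mul_comm C]
          exact mul_le_mul_of_nonneg_left ht he0
  -- Vertices of the cube are nodes. Choosing each coordinate's end by the sign of `a k` makes the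
  -- affine part nonpositive or nonnegative relative to `x`, so the truncation levels miss `v x` by
  -- at most `e`.
  have corner : ∀ p : Fin N → Prop, [DecidablePred p] →
      (fun k => if p k then (1 : ℝ) else -1) ∈ refNodes N M := by
    intro p _
    rw [mem_refNodes]
    intro k
    split_ifs
    · exact one_mem_gllNodes M
    · exact neg_one_mem_gllNodes M
  rw [abs_le] at hint ⊢
  have hmin : (refNodes N M).inf' (refNodes_nonempty N M) (fun ξ => v (gridPoint δ i ξ)) ≤
      v x + e := by
    have hξ := corner fun k => a k ≤ 0
    refine (Finset.inf'_le _ hξ).trans ?_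
    have := (abs_le.1 (he _ hξ)).2
    have hs : ∑ k, a k * (gridPoint δ i (fun k => if a k ≤ 0 then (1 : ℝ) else -1) k - x k) ≤
        0 := by
      refine Finset.sum_nonpos fun k _ => ?_
      simp only [gridPoint]
      split_ifs with h
      · exact mul_nonpos_of_nonpos_of_nonneg h (by linarith [(hx k).2])
      · exact mul_nonpos_of_nonneg_of_nonpos (not_le.1 h).le (by linarith [(hx k).1])
    linarith
  have hmax : v x - e ≤
      (refNodes N M).sup' (refNodes_nonempty N M) (fun ξ => v (gridPoint δ i ξ)) := by
    have hξ := corner fun k => 0 ≤ a k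
    refine le_trans ?_ (Finset.le_sup' (fun ξ => v (gridPoint δ i ξ)) hξ)
    have := (abs_le.1 (he _ hξ)).1
    have hs : 0 ≤
        ∑ k, a k * (gridPoint δ i (fun k => if 0 ≤ a k then (1 : ℝ) else -1) k - x k) := by
      refine Finset.sum_nonneg fun k _ => ?_
      simp only [gridPoint]
      split_ifs with h
      · exact mul_nonneg h (by linarith [(hx k).2])
      · exact mul_nonneg_of_nonpos_of_nonpos (not_le.1 h).le (by linarith [(hx k).1])
    linarith
  unfold meshTrunc
  constructor
  · have : v x - C * e ≤ min (meshInterp δ M i v x)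
      ((refNodes N M).sup' (refNodes_nonempty N M) fun ξ => v (gridPoint δ i ξ)) :=
      le_min (by linarith) (by linarith)
    rw [neg_le_sub_iff_le_add, ← sub_le_iff_le_add]
    exact le_max_of_le_right this
  · rw [sub_le_iff_le_add']
    exact max_le (by linarith) ((min_le_left _ _).trans (by linarith))

end Mesh

/-! ### Local finiteness of the meshes -/

section Grid

variable {N M : ℕ} {δ : ℝ}

/-- Only finitely many meshes meet a ball. -/
theorem finite_meshes_meeting_ball (hδ : 0 < δ) (x : E N) (r : ℝ) :
    {i : Fin N → ℤ | ∃ y ∈ Metric.ball x r,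
      ∀ k, (i k : ℝ) * δ ≤ y k ∧ y k ≤ ((i k : ℝ) + 1) * δ}.Finite := by
  refine (Set.Finite.pi' fun k : Fin N =>
    Set.finite_Icc ⌊(x k - r) / δ - 1⌋ ⌈(x k + r) / δ⌉).subset ?_
  rintro i ⟨y, hy, h⟩ k
  have hk : |y k - x k| < r := by
    have := (PiLp.norm_apply_le (y - x) k).trans_lt (mem_ball_iff_norm.1 hy)
    simpa using this
  rw [abs_lt] at hk
  constructor
  · have : (x k - r) / δ - 1 < i k := by
      rw [sub_lt_iff_lt_add, div_lt_iff₀ hδ]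
      linarith [(h k).2]
    exact Int.cast_le.1 ((Int.floor_le _).trans this.le)
  · have : (i k : ℝ) < (x k + r) / δ := by
      rw [lt_div_iff₀ hδ]
      linarith [(h k).1]
    exact Int.cast_le.1 (this.le.trans (Int.le_ceil _))

/-- Every function is continuous on the grid. -/
theorem continuousOn_grid (hδ : 0 < δ) (f : E N → ℝ) : ContinuousOn f (grid N δ M) := by
  intro x hx
  -- Continuity is local, and the grid meets a unit ball in a finite set.
  rw [← continuousWithinAt_inter (Metric.ball_mem_nhds x one_pos)]
  refine Set.Finite.continuousOn ?_ f x ⟨hx, Metric.mem_ball_self one_pos⟩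
  refine (((finite_meshes_meeting_ball hδ x 1).prod (refNodes N M).finite_toSet).image
    fun p => gridPoint δ p.1 p.2).subset ?_
  rintro y ⟨⟨i, ξ, hξ, rfl⟩, hy⟩
  exact ⟨(i, ξ), ⟨⟨_, hy, gridPoint_mem_mesh hδ i hξ⟩, hξ⟩, rfl⟩

/-- On the line, the truncated interpolants on two meshes agree on their intersection. -/
theorem meshTrunc_eq_of_mem (hδ : 0 < δ) {i j : Fin 1 → ℤ} {x : E 1} (v : E 1 → ℝ)
    (hi : ∀ k, (i k : ℝ) * δ ≤ x k ∧ x k ≤ ((i k : ℝ) + 1) * δ)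
    (hj : ∀ k, (j k : ℝ) * δ ≤ x k ∧ x k ≤ ((j k : ℝ) + 1) * δ) :
    meshTrunc δ M i v x = meshTrunc δ M j v x := by
  wlog hij : i 0 ≤ j 0 generalizing i j
  · exact (this hj hi (le_of_not_ge hij)).symm
  rcases hij.eq_or_lt with h | h
  · rw [show i = j from funext fun k => by rwa [Subsingleton.elim k 0]]
  · have hij : (i 0 : ℝ) + 1 ≤ j 0 := by exact_mod_cast h
    -- Two distinct intervals sharing `x` must touch end to end: `x` is the right end of `i` and the
    -- left end of `j`, a node of both.
    have h1 := mul_le_mul_of_nonneg_right hij hδ.le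
    have hxi : x = gridPoint δ i fun _ => 1 := by
      ext k
      rw [Subsingleton.elim k 0]
      simp only [gridPoint]
      linarith [(hi 0).2, (hj 0).1]
    have hxj : x = gridPoint δ j fun _ => -1 := by
      ext k
      rw [Subsingleton.elim k 0]
      simp only [gridPoint]
      linarith [(hi 0).2, (hj 0).1]
    have ei : meshTrunc δ M i v x = v x := by
      rw [hxi]
      exact meshTrunc_gridPoint hδ.ne' i v (mem_refNodes.2 fun _ => one_mem_gllNodes M)
    have ej : meshTrunc δ M j v x = v x := by
      rw [hxj]
      exact meshTrunc_gridPoint hδ.ne' j v (mem_refNodes.2 fun _ => neg_one_mem_gllNodes M)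
    rw [ei, ej]

/-- The closed meshes form a locally finite cover, and on each of them the interpolant coincides
with the continuous one of that mesh, whichever mesh was selected. -/
theorem continuous_truncInterp_line (hδ : 0 < δ) {κ : E 1 → Fin 1 → ℤ} (hκ : IsMeshSelection δ κ)
    (v : E 1 → ℝ) : Continuous (truncInterp δ M κ v) := by
  refine LocallyFinite.continuous (f := fun i : Fin 1 → ℤ =>
    {x : E 1 | ∀ k, (i k : ℝ) * δ ≤ x k ∧ x k ≤ ((i k : ℝ) + 1) * δ}) ?_ ?_ ?_ ?_
  · intro x
    refine ⟨_, Metric.ball_mem_nhds x one_pos, (finite_meshes_meeting_ball hδ x 1).subset ?_⟩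
    rintro i ⟨y, h, hy⟩
    exact ⟨y, hy, h⟩
  · exact eq_univ_of_forall fun x => mem_iUnion.2 ⟨κ x, hκ x⟩
  · intro i
    simp only [ofPred_forall, ofPred_and]
    refine isClosed_iInter fun k => IsClosed.inter ?_ ?_
    · exact isClosed_le continuous_const (by fun_prop)
    · exact isClosed_le (by fun_prop) continuous_const
  · intro i
    refine (continuous_meshTrunc (δ := δ) (M := M) i v).continuousOn.congr fun x hx => ?_
    exact meshTrunc_eq_of_mem hδ v (hκ x) hx

end Grid

/-! ### Taylor estimates -/

section Taylor

variable {X Y : Type*} [NormedAddCommGroup X] [NormedSpace ℝ X] [NormedAddCommGroup Y]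
  [NormedSpace ℝ Y]

theorem two_le_infty : (2 : WithTop ℕ∞) ≤ (∞ : ℕ∞ω) :=
  WithTop.coe_le_coe.2 (le_top : (2 : ℕ∞) ≤ ⊤)

theorem norm_fderiv_fderiv (G : X → Y) (x : X) :
    ‖fderiv ℝ (fderiv ℝ G) x‖ = ‖iteratedFDeriv ℝ 2 G x‖ := by
  rw [← norm_iteratedFDeriv_one, norm_iteratedFDeriv_fderiv]

theorem norm_sub_le_of_norm_fderiv_le {G : X → Y} (hG : Differentiable ℝ G) {C : ℝ}
    (hC : ∀ x, ‖fderiv ℝ G x‖ ≤ C) (x y : X) : ‖G y - G x‖ ≤ C * ‖y - x‖ :=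
  convex_univ.norm_image_sub_le_of_norm_fderiv_le (fun z _ => hG z) (fun z _ => hC z)
    (mem_univ x) (mem_univ y)

/-- First-order Taylor remainder. -/
theorem norm_taylor_one_le {G : X → Y} (hG : ContDiff ℝ 2 G) {C : ℝ}
    (hC : ∀ x, ‖iteratedFDeriv ℝ 2 G x‖ ≤ C) (x v : X) :
    ‖G (x + v) - G x - fderiv ℝ G x v‖ ≤ C * ‖v‖ ^ 2 := by
  have hd : Differentiable ℝ (fderiv ℝ G) :=
    (hG.fderiv_right (m := 1) (by norm_num)).differentiable (by norm_num)
  have hC0 : 0 ≤ C := (norm_nonneg _).trans (hC x)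
  -- Mean value inequality for `G` minus its differential at `x`; the derivative of this difference
  -- is at most `C * ‖v‖` on the segment. The sharp factor 1/2 is not needed.
  have h := (convex_segment x (x + v)).norm_image_sub_le_of_norm_fderiv_le' (f := G)
    (C := C * ‖v‖) (φ := fderiv ℝ G x) (𝕜 := ℝ)
    (fun z _ => (hG.differentiable (by norm_num)) z) (fun z hz => ?_) (left_mem_segment ℝ _ _)
    (right_mem_segment ℝ _ _)
  · rw [add_sub_cancel_left] at h
    linarith [h]
  · refine (norm_sub_le_of_norm_fderiv_le hd
      (fun z => (norm_fderiv_fderiv G z).trans_le (hC z)) x z).trans ?_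
    refine mul_le_mul_of_nonneg_left ?_ hC0
    have := norm_sub_le_of_mem_segment hz
    rwa [add_sub_cancel_left] at this

/-- Landau's inequality: the first derivative is controlled by the function and its second
derivative. -/
theorem norm_fderiv_le_of_norm_le {G : X → Y} (hG : ContDiff ℝ 2 G) {B C : ℝ}
    (hB : ∀ x, ‖G x‖ ≤ B) (hC : ∀ x, ‖iteratedFDeriv ℝ 2 G x‖ ≤ C) (x : X) :
    ‖fderiv ℝ G x‖ ≤ 2 * B + C := by
  have hC0 : 0 ≤ C := (norm_nonneg _).trans (hC x)
  have hB0 : 0 ≤ B := (norm_nonneg _).trans (hB x)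
  refine ContinuousLinearMap.opNorm_le_of_unit_norm (by positivity) fun v hv => ?_
  have h := norm_taylor_one_le hG hC x v
  rw [hv, one_pow, mul_one] at h
  have h2 : fderiv ℝ G x v = G (x + v) - G x - (G (x + v) - G x - fderiv ℝ G x v) := by abel
  rw [h2]
  have h3 := norm_sub_le (G (x + v) - G x) (G (x + v) - G x - fderiv ℝ G x v)
  have h4 := norm_sub_le (G (x + v)) (G x)
  linarith [hB x, hB (x + v)]

/-- In the sum of the Taylor estimates for `v` and `-v` the first-order terms cancel. -/
theorem norm_second_difference_le {G : X → Y} (hG : ContDiff ℝ 2 G) {C : ℝ}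
    (hC : ∀ x, ‖iteratedFDeriv ℝ 2 G x‖ ≤ C) (x v : X) :
    ‖G (x + v) + G (x - v) - (2 : ℝ) • G x‖ ≤ 2 * C * ‖v‖ ^ 2 := by
  have h1 := norm_taylor_one_le hG hC x v
  have h2 := norm_taylor_one_le hG hC x (-v)
  rw [norm_neg, map_neg, ← sub_eq_add_neg] at h2
  have : G (x + v) + G (x - v) - (2 : ℝ) • G x =
      (G (x + v) - G x - fderiv ℝ G x v) + (G (x - v) - G x - -fderiv ℝ G x v) := by
    rw [two_smul]; abel
  rw [this]
  linarith [norm_add_le (G (x + v) - G x - fderiv ℝ G x v) (G (x - v) - G x - -fderiv ℝ G x v)]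

/-- Fourth-order remainder of the symmetric second difference. -/
theorem abs_second_difference_sub_le {φ : X → ℝ} (hφ : ContDiff ℝ ∞ φ) {C : ℝ}
    (hC : ∀ x, ‖iteratedFDeriv ℝ 4 φ x‖ ≤ C) (x v : X) :
    |φ (x + v) + φ (x - v) - 2 * φ x - fderiv ℝ (fderiv ℝ φ) x v v| ≤ 2 * C * ‖v‖ ^ 4 := by
  have hφ1 : ContDiff ℝ ∞ (fderiv ℝ φ) := hφ.fderiv_right (by simp)
  have hφ2 : ContDiff ℝ ∞ (fderiv ℝ (fderiv ℝ φ)) := hφ1.fderiv_right (by simp)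
  have hd : Differentiable ℝ φ := hφ.differentiable (by simp)
  have hd1 : Differentiable ℝ (fderiv ℝ φ) := hφ1.differentiable (by simp)
  have hC0 : 0 ≤ C := (norm_nonneg _).trans (hC x)
  set G := fderiv ℝ (fderiv ℝ φ) with hGdef
  have hC' : ∀ x, ‖iteratedFDeriv ℝ 2 G x‖ ≤ C := fun x => by
    rw [hGdef, norm_iteratedFDeriv_fderiv, norm_iteratedFDeriv_fderiv]
    exact hC x
  have hline : ∀ s t : ℝ, HasDerivAt (fun t : ℝ => x + (s * t) • v) (s • v) t := by
    intro s t
    simpa using (((hasDerivAt_id t).const_mul s).smul_const v).const_add x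
  -- the remainder along the line through `x` in direction `v` and its derivatives
  set r : ℝ → ℝ := fun t =>
    φ (x + (1 * t) • v) + φ (x + (-1 * t) • v) - 2 * φ x - t ^ 2 * G x v v with hr
  set r' : ℝ → ℝ := fun t =>
    fderiv ℝ φ (x + (1 * t) • v) v - fderiv ℝ φ (x + (-1 * t) • v) v -
    2 * t * G x v v with hr'
  have hrd : ∀ t, HasDerivAt r (r' t) t := by
    intro t
    have h1 := ((hd _).hasFDerivAt).comp_hasDerivAt t (hline 1 t)
    have h2 := ((hd _).hasFDerivAt).comp_hasDerivAt t (hline (-1) t)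
    have h3 := (((h1.add h2).sub_const (2 * φ x)).sub
      (((hasDerivAt_id t).pow 2).mul_const (G x v v)))
    refine h3.congr_deriv ?_
    simp [hr']
    ring
  have hrd' : ∀ t, HasDerivAt r'
      ((G (x + (1 * t) • v) + G (x + (-1 * t) • v) - (2 : ℝ) • G x) v v) t := by
    intro t
    have h1 := (((hd1 _).hasFDerivAt).comp_hasDerivAt t (hline 1 t)).clm_apply
      (hasDerivAt_const t v)
    have h2 := (((hd1 _).hasFDerivAt).comp_hasDerivAt t (hline (-1) t)).clm_apply
      (hasDerivAt_const t v)
    have h3 := (h1.sub h2).sub (((hasDerivAt_id t).const_mul 2).mul_const (G x v v))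
    refine h3.congr_deriv ?_
    simp [hGdef]
  -- The second derivative of the remainder is a symmetric second difference of the Hessian, hence
  -- controlled by the fourth derivative of `φ`.
  have hb : ∀ t ∈ Icc (0 : ℝ) 1,
      ‖(G (x + (1 * t) • v) + G (x + (-1 * t) • v) - (2 : ℝ) • G x) v v‖ ≤ 2 * C * ‖v‖ ^ 4 := by
    intro t ht
    have h := norm_second_difference_le (hφ2.of_le two_le_infty) hC' x (t • v)
    rw [show x + t • v = x + (1 * t) • v by simp,
      show x - t • v = x + (-1 * t) • v by simp [sub_eq_add_neg]] at h
    refine (ContinuousLinearMap.le_opNorm₂ _ v v).trans ?_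
    have ht2 : ‖t • v‖ ^ 2 ≤ ‖v‖ ^ 2 := by
      refine pow_le_pow_left₀ (norm_nonneg _) ?_ 2
      rw [norm_smul, Real.norm_of_nonneg ht.1]
      exact mul_le_of_le_one_left (norm_nonneg _) ht.2
    have h5 := h.trans (mul_le_mul_of_nonneg_left ht2 (by positivity))
    calc _ ≤ 2 * C * ‖v‖ ^ 2 * ‖v‖ * ‖v‖ := by gcongr
      _ = _ := by ring
  -- Since `r` and `r'` vanish at 0, two mean value inequalities on `[0, 1]` carry the bound over to
  -- `r 1`.
  have hb' : ∀ t ∈ Icc (0 : ℝ) 1, ‖r' t‖ ≤ 2 * C * ‖v‖ ^ 4 := by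
    intro t ht
    have h := (convex_Icc (0 : ℝ) 1).norm_image_sub_le_of_norm_hasDerivWithin_le
      (fun s _ => (hrd' s).hasDerivWithinAt) hb (left_mem_Icc.2 zero_le_one) ht
    have h0 : r' 0 = 0 := by simp [hr']
    rw [h0, sub_zero, sub_zero, Real.norm_of_nonneg ht.1] at h
    exact h.trans (mul_le_of_le_one_right (by positivity) ht.2)
  have h := (convex_Icc (0 : ℝ) 1).norm_image_sub_le_of_norm_hasDerivWithin_le
    (fun s _ => (hrd s).hasDerivWithinAt) hb' (left_mem_Icc.2 zero_le_one)
    (right_mem_Icc.2 zero_le_one)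
  have h0 : r 0 = 0 := by simp [hr]; ring
  rw [h0, sub_zero, sub_zero, norm_one, mul_one] at h
  simpa [hr, ← sub_eq_add_neg] using h

/-- One step of the weak Euler scheme: the second difference around a translated point. -/
theorem abs_euler_step_sub_le {φ : X → ℝ} (hφ : ContDiff ℝ ∞ φ) {B C : ℝ}
    (hB : ∀ x, ‖iteratedFDeriv ℝ 2 φ x‖ ≤ B)
    (hC : ∀ x, ‖iteratedFDeriv ℝ 4 φ x‖ ≤ C) (x y z : X) :
    |φ (x + (y + z)) + φ (x + (y - z)) - 2 * φ x - 2 * fderiv ℝ φ x y -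
      fderiv ℝ (fderiv ℝ φ) x z z| ≤
      2 * C * ‖z‖ ^ 4 + (2 * B + C) * ‖y‖ * ‖z‖ ^ 2 + 2 * (B * ‖y‖ ^ 2) := by
  have hφ1 : ContDiff ℝ ∞ (fderiv ℝ φ) := hφ.fderiv_right (by simp)
  have hφ2 : ContDiff ℝ ∞ (fderiv ℝ (fderiv ℝ φ)) := hφ1.fderiv_right (by simp)
  have h1 := abs_second_difference_sub_le hφ hC (x + y) z
  have h2 := norm_taylor_one_le (hφ.of_le two_le_infty) hB x y
  have hB' : ∀ x, ‖fderiv ℝ (fderiv ℝ φ) x‖ ≤ B := fun x =>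
    (norm_fderiv_fderiv φ x).trans_le (hB x)
  have hC' : ∀ x, ‖iteratedFDeriv ℝ 2 (fderiv ℝ (fderiv ℝ φ)) x‖ ≤ C := fun x => by
    rw [norm_iteratedFDeriv_fderiv, norm_iteratedFDeriv_fderiv]
    exact hC x
  -- Moving the Hessian from `x + y` to `x` costs a third derivative; Landau's inequality applied to
  -- the Hessian replaces it by `2 * B + C`.
  have h3 : |(fderiv ℝ (fderiv ℝ φ) (x + y) - fderiv ℝ (fderiv ℝ φ) x) z z| ≤
      (2 * B + C) * ‖y‖ * ‖z‖ ^ 2 := by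
    have h := norm_sub_le_of_norm_fderiv_le (hφ2.differentiable (by simp))
      (norm_fderiv_le_of_norm_le (hφ2.of_le two_le_infty) hB' hC') x (x + y)
    rw [add_sub_cancel_left] at h
    refine (ContinuousLinearMap.le_opNorm₂ (fderiv ℝ (fderiv ℝ φ) (x + y) -
      fderiv ℝ (fderiv ℝ φ) x) z z).trans ?_
    calc _ ≤ (2 * B + C) * ‖y‖ * ‖z‖ * ‖z‖ := by gcongr
      _ = _ := by ring
  rw [Real.norm_eq_abs] at h2
  simp only [sub_apply] at h3
  rw [← add_assoc, ← add_sub_assoc]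
  rw [abs_le] at *
  constructor <;> linarith [h1.1, h1.2, h2.1, h2.2, h3.1, h3.2]

end Taylor

/-! ### Consequences of finite norms -/

section Norms

variable {N : ℕ} {V : Type*} [NormedAddCommGroup V]

theorem norm_le_toReal_supNorm {f : E N → V} (hf : supNorm f ≠ ⊤) (x : E N) :
    ‖f x‖ ≤ (supNorm f).toReal := by
  have h : ‖f x‖ₑ ≤ supNorm f := le_iSup (fun x => ‖f x‖ₑ) x
  simpa using ENNReal.toReal_mono hf h

theorem norm_sub_le_toReal_lipSeminorm {f : E N → V} (hf : lipSeminorm f ≠ ⊤) (x y : E N) :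
    ‖f x - f y‖ ≤ (lipSeminorm f).toReal * ‖x - y‖ := by
  rcases eq_or_ne x y with rfl | hxy
  · simp
  have h : ‖f x - f y‖ₑ / ‖x - y‖ₑ ≤ lipSeminorm f :=
    le_iSup_of_le x (le_iSup_of_le y (le_iSup_of_le hxy le_rfl))
  have h2 := ENNReal.toReal_mono hf h
  rw [ENNReal.toReal_div, toReal_enorm, toReal_enorm,
    div_le_iff₀ (norm_pos_iff.2 (sub_ne_zero.2 hxy))] at h2
  exact h2

theorem norm_le_of_lipNorm_le {f : E N → V} {K : ℝ} (hK : 0 ≤ K)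
    (hf : lipNorm f ≤ ENNReal.ofReal K) (x : E N) : ‖f x‖ ≤ K := by
  have h : supNorm f ≤ ENNReal.ofReal K := le_self_add.trans hf
  have hne : supNorm f ≠ ⊤ := (h.trans_lt ENNReal.ofReal_lt_top).ne
  exact (norm_le_toReal_supNorm hne x).trans (ENNReal.toReal_le_of_le_ofReal hK h)

theorem norm_sub_le_of_lipNorm_le {f : E N → V} {K : ℝ} (hK : 0 ≤ K)
    (hf : lipNorm f ≤ ENNReal.ofReal K) (x y : E N) : ‖f x - f y‖ ≤ K * ‖x - y‖ := by
  have h : lipSeminorm f ≤ ENNReal.ofReal K := le_add_self.trans hf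
  have hne : lipSeminorm f ≠ ⊤ := (h.trans_lt ENNReal.ofReal_lt_top).ne
  exact (norm_sub_le_toReal_lipSeminorm hne x y).trans
    (mul_le_mul_of_nonneg_right (ENNReal.toReal_le_of_le_ofReal hK h) (norm_nonneg _))

theorem MemC01.abs_sub_le {w : E N → ℝ} (hw : MemC01 w) (x y : E N) :
    |w x - w y| ≤ (lipNorm w).toReal * ‖x - y‖ :=
  norm_sub_le_of_lipNorm_le ENNReal.toReal_nonneg (ENNReal.ofReal_toReal (ne_of_lt hw)).ge x y

theorem MemC01.supNorm_lt_top {w : E N → ℝ} (hw : MemC01 w) : supNorm w < ⊤ :=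
  le_self_add.trans_lt hw

theorem exists_abs_le {φ : E N → ℝ} (h : supNorm φ < ⊤) : ∃ B, 0 ≤ B ∧ ∀ x, |φ x| ≤ B :=
  ⟨_, ENNReal.toReal_nonneg, norm_le_toReal_supNorm h.ne⟩

theorem abs_truncInterp_le {φ : E N → ℝ} {B : ℝ} (hB : ∀ x, |φ x| ≤ B) (δ : ℝ) (M : ℕ)
    (κ : E N → Fin N → ℤ) (x : E N) : |truncInterp δ M κ φ x| ≤ B := by
  obtain ⟨ξ, -, h1⟩ := exists_le_meshTrunc (δ := δ) (M := M) (κ x) φ x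
  obtain ⟨η, -, h2⟩ := exists_meshTrunc_le (δ := δ) (M := M) (κ x) φ x
  rw [truncInterp_eq_meshTrunc, abs_le]
  exact ⟨(abs_le.1 (hB _)).1.trans h1, h2.trans (abs_le.1 (hB _)).2⟩

/-- The interpolation error of a function with bounded second derivative. -/
theorem exists_truncInterp_error (N M : ℕ) : ∃ C : ℝ, 0 ≤ C ∧
    ∀ (δ : ℝ) (κ : E N → Fin N → ℤ) (φ : E N → ℝ) (B : ℝ), 0 < δ → IsMeshSelection δ κ →
    ContDiff ℝ ∞ φ → (∀ x, ‖iteratedFDeriv ℝ 2 φ x‖ ≤ B) →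
    ∀ x, |truncInterp δ M κ φ x - φ x| ≤ C * δ ^ 2 * B := by
  obtain ⟨C, hC1, hC⟩ := exists_meshTrunc_error N M
  refine ⟨C * N, by positivity, fun δ κ φ B hδ hκ hφ hB x => ?_⟩
  have hB0 : 0 ≤ B := (norm_nonneg _).trans (hB x)
  rw [truncInterp_eq_meshTrunc]
  -- The comparison function is the first-order Taylor polynomial at `x`, and `√N * δ` is the
  -- diameter of the mesh.
  refine (hC δ (κ x) φ x (fun k => fderiv ℝ φ x (EuclideanSpace.single k 1))
    (B * (√N * δ) ^ 2) hδ (hκ x) fun ξ hξ => ?_).trans_eq ?_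
  · have h := norm_taylor_one_le (hφ.of_le two_le_infty) hB x (gridPoint δ (κ x) ξ - x)
    have hs : ∑ k, fderiv ℝ φ x (EuclideanSpace.single k 1) * (gridPoint δ (κ x) ξ k - x k) =
        fderiv ℝ φ x (gridPoint δ (κ x) ξ - x) := by
      conv_rhs => rw [← (EuclideanSpace.basisFun (Fin N) ℝ).sum_repr (gridPoint δ (κ x) ξ - x)]
      rw [map_sum]
      refine Finset.sum_congr rfl fun k _ => ?_
      simp [mul_comm]
    rw [add_sub_cancel, Real.norm_eq_abs] at h
    rw [hs, ← sub_sub]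
    refine h.trans (mul_le_mul_of_nonneg_left ?_ hB0)
    exact pow_le_pow_left₀ (norm_nonneg _)
      (dist_le_of_mem_mesh hδ.le (gridPoint_mem_mesh hδ _ hξ) (hκ x)) 2
  · rw [mul_pow, Real.sq_sqrt (Nat.cast_nonneg N)]
    ring

end Norms

/-! ### Suprema -/

section Sup

variable {ι : Type*} [Nonempty ι] {f g : ι → ℝ} {C : ℝ}

theorem ciSup_le_ciSup_add (hg : BddAbove (range g)) (h : ∀ i, f i ≤ g i + C) :
    ⨆ i, f i ≤ (⨆ i, g i) + C :=
  ciSup_le fun i => (h i).trans (by linarith [le_ciSup hg i])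

/-- Boundedness of one family suffices, since uniform closeness passes it to the other. -/
theorem abs_ciSup_sub_le (hg : BddAbove (range g)) (h : ∀ i, |f i - g i| ≤ C) :
    |(⨆ i, f i) - ⨆ i, g i| ≤ C := by
  have hf : BddAbove (range f) := by
    obtain ⟨B, hB⟩ := hg
    refine ⟨B + C, ?_⟩
    rintro _ ⟨i, rfl⟩
    linarith [(abs_le.1 (h i)).2, hB ⟨i, rfl⟩]
  have h1 := ciSup_le_ciSup_add (f := f) (C := C) hg fun i => by linarith [(abs_le.1 (h i)).2]
  have h2 := ciSup_le_ciSup_add (f := g) (C := C) hf fun i => by linarith [(abs_le.1 (h i)).1]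
  rw [abs_le]
  constructor <;> linarith

theorem abs_ciSup_le (h : ∀ i, |f i| ≤ C) : |⨆ i, f i| ≤ C := by
  have := abs_ciSup_sub_le (f := f) (g := fun _ => 0) (C := C)
    ⟨0, by rintro _ ⟨i, rfl⟩; exact le_rfl⟩ (by simpa using h)
  simpa using this

/-- An estimate by a weighted sum of possibly infinite norms only has to be checked when the norms
are finite. -/
theorem enorm_le_ofReal_mul_sum {I : Finset ℕ} (hC : 0 < C) {w : ℕ → ℝ} (hw : ∀ i ∈ I, 0 < w i)
    {s : ℕ → ℝ≥0∞} {x : ℝ}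
    (hx : (∀ i ∈ I, s i ≠ ⊤) → |x| ≤ C * ∑ i ∈ I, w i * (s i).toReal) :
    ‖x‖ₑ ≤ ENNReal.ofReal C * ∑ i ∈ I, ENNReal.ofReal (w i) * s i := by
  by_cases h : ∀ i ∈ I, s i ≠ ⊤
  · have h1 : ∑ i ∈ I, ENNReal.ofReal (w i) * s i =
        ENNReal.ofReal (∑ i ∈ I, w i * (s i).toReal) := by
      rw [ENNReal.ofReal_sum_of_nonneg fun i hi =>
        mul_nonneg (hw i hi).le ENNReal.toReal_nonneg]
      refine Finset.sum_congr rfl fun i hi => ?_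
      rw [ENNReal.ofReal_mul (hw i hi).le, ENNReal.ofReal_toReal (h i hi)]
    rw [h1, ← ENNReal.ofReal_mul hC.le, Real.enorm_eq_ofReal_abs]
    exact ENNReal.ofReal_le_ofReal (hx h)
  · push Not at h
    obtain ⟨i, hi, htop⟩ := h
    have h1 : ∑ i ∈ I, ENNReal.ofReal (w i) * s i = ⊤ := by
      refine ENNReal.sum_eq_top.2 ⟨i, hi, ?_⟩
      rw [htop, ENNReal.mul_top (ENNReal.ofReal_pos.2 (hw i hi)).ne']
    rw [h1, ENNReal.mul_top (ENNReal.ofReal_pos.2 hC).ne']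
    exact le_top

end Sup

/-! ### Coefficients -/

section Coefficients

variable {A : Type*} {N P : ℕ} {D : Coeffs A N P} {lam K : ℝ}

theorem norm_col_le (m : Matrix (Fin N) (Fin P) ℝ) (i : Fin P) :
    ‖(WithLp.toLp 2 fun k => m k i : E N)‖ ≤ ‖m‖ := by
  rw [EuclideanSpace.norm_eq, Matrix.frobenius_norm_def, ← Real.sqrt_eq_rpow]
  refine Real.sqrt_le_sqrt (Finset.sum_le_sum fun k _ => ?_)
  simp only [Real.rpow_two]
  exact Finset.single_le_sum (f := fun j => ‖m k j‖ ^ 2) (fun j _ => by positivity)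
    (Finset.mem_univ i)

namespace Coeffs.Bounds

/-- For negative `K` the bound on `c` would read 0, against `c ≥ lam > 0`. -/
theorem K_nonneg [Nonempty A] (hD : D.Bounds lam K) : 0 ≤ K := by
  by_contra hK
  obtain ⟨α⟩ := ‹Nonempty A›
  have h : ‖D.c α 0‖ₑ ≤ ENNReal.ofReal K := (le_iSup (fun x => ‖D.c α x‖ₑ) 0).trans (hD.c_le α)
  rw [ENNReal.ofReal_of_nonpos (not_le.1 hK).le, nonpos_iff_eq_zero, enorm_eq_zero] at h
  linarith [hD.lam_le α 0, hD.lam_pos]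

theorem abs_c_le [Nonempty A] (hD : D.Bounds lam K) (α : A) (x : E N) : |D.c α x| ≤ K := by
  have hne : supNorm (D.c α) ≠ ⊤ := ((hD.c_le α).trans_lt ENNReal.ofReal_lt_top).ne
  exact (norm_le_toReal_supNorm hne x).trans
    (ENNReal.toReal_le_of_le_ofReal hD.K_nonneg (hD.c_le α))

theorem c_nonneg (hD : D.Bounds lam K) (α : A) (x : E N) : 0 ≤ D.c α x :=
  hD.lam_pos.le.trans (hD.lam_le α x)

theorem lipNorm_σ_le (hD : D.Bounds lam K) (α : A) : lipNorm (D.σ α) ≤ ENNReal.ofReal K :=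
  (le_self_add.trans le_self_add).trans (hD.norm_le α)

theorem lipNorm_b_le (hD : D.Bounds lam K) (α : A) : lipNorm (D.b α) ≤ ENNReal.ofReal K :=
  (le_add_self.trans le_self_add).trans (hD.norm_le α)

theorem lipNorm_f_le (hD : D.Bounds lam K) (α : A) : lipNorm (D.f α) ≤ ENNReal.ofReal K :=
  le_add_self.trans (hD.norm_le α)

theorem norm_b_le [Nonempty A] (hD : D.Bounds lam K) (α : A) (x : E N) : ‖D.b α x‖ ≤ K :=
  norm_le_of_lipNorm_le hD.K_nonneg (hD.lipNorm_b_le α) x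

theorem abs_f_le [Nonempty A] (hD : D.Bounds lam K) (α : A) (x : E N) : |D.f α x| ≤ K :=
  norm_le_of_lipNorm_le hD.K_nonneg (hD.lipNorm_f_le α) x

theorem norm_col_le [Nonempty A] (hD : D.Bounds lam K) (α : A) (x : E N) (i : Fin P) :
    ‖D.col α x i‖ ≤ K :=
  (HJB.norm_col_le _ i).trans (norm_le_of_lipNorm_le hD.K_nonneg (hD.lipNorm_σ_le α) x)

theorem norm_b_sub_le [Nonempty A] (hD : D.Bounds lam K) (α : A) (x y : E N) :
    ‖D.b α x - D.b α y‖ ≤ K * ‖x - y‖ :=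
  norm_sub_le_of_lipNorm_le hD.K_nonneg (hD.lipNorm_b_le α) x y

theorem abs_f_sub_le [Nonempty A] (hD : D.Bounds lam K) (α : A) (x y : E N) :
    |D.f α x - D.f α y| ≤ K * ‖x - y‖ :=
  norm_sub_le_of_lipNorm_le hD.K_nonneg (hD.lipNorm_f_le α) x y

theorem norm_col_sub_le [Nonempty A] (hD : D.Bounds lam K) (α : A) (x y : E N) (i : Fin P) :
    ‖D.col α x i - D.col α y i‖ ≤ K * ‖x - y‖ :=
  (HJB.norm_col_le (D.σ α x - D.σ α y) i).trans
    (norm_sub_le_of_lipNorm_le hD.K_nonneg (hD.lipNorm_σ_le α) x y)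

end Coeffs.Bounds

/-! ### The averaging operator -/

theorem mean_le (hP : 1 ≤ P) {F : Fin P → ℝ} {e : ℝ} (h : ∀ i, F i ≤ 2 * e) :
    1 / (2 * P : ℝ) * ∑ i, F i ≤ e := by
  have hP' : (0 : ℝ) < P := by exact_mod_cast hP
  have := Finset.sum_le_sum fun i (_ : i ∈ Finset.univ) => h i
  simp only [Finset.sum_const, Finset.card_univ, Fintype.card_fin, nsmul_eq_mul] at this
  rw [one_div, inv_mul_le_iff₀ (by positivity)]
  linarith

theorem abs_mean_le (hP : 1 ≤ P) {F : Fin P → ℝ} {e : ℝ} (h : ∀ i, |F i| ≤ 2 * e) :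
    |1 / (2 * P : ℝ) * ∑ i, F i| ≤ e := by
  rw [abs_le']
  refine ⟨mean_le hP fun i => (le_abs_self _).trans (h i), ?_⟩
  rw [← mul_neg, ← Finset.sum_neg_distrib]
  exact mean_le hP fun i => (neg_le_abs _).trans (h i)

theorem average_sub (h : ℝ) (α β : A) (y y' : E N) (ψ ψ' : E N → ℝ) :
    D.average h α y ψ - D.average h β y' ψ' = 1 / (2 * P : ℝ) * ∑ i : Fin P,
      ((ψ (h • D.b α y + √(h * P) • D.col α y i) + ψ (h • D.b α y - √(h * P) • D.col α y i)) -
      (ψ' (h • D.b β y' + √(h * P) • D.col β y' i) +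
        ψ' (h • D.b β y' - √(h * P) • D.col β y' i))) := by
  unfold Coeffs.average
  rw [← mul_sub, ← Finset.sum_sub_distrib]

/-- The average has nonnegative weights of sum 1. -/
theorem average_le_average_add (hP : 1 ≤ P) {h e : ℝ} {α : A} {y : E N} {ψ χ : E N → ℝ}
    (H : ∀ z, ψ z ≤ χ z + e) : D.average h α y ψ ≤ D.average h α y χ + e := by
  rw [← sub_le_iff_le_add', average_sub]
  refine mean_le hP fun i => ?_
  linarith [H (h • D.b α y + √(h * P) • D.col α y i), H (h • D.b α y - √(h * P) • D.col α y i)]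

theorem abs_average_sub_le (hP : 1 ≤ P) {h e : ℝ} {α : A} {y : E N} {ψ χ : E N → ℝ}
    (H : ∀ z, |ψ z - χ z| ≤ e) : |D.average h α y ψ - D.average h α y χ| ≤ e := by
  rw [abs_le]
  constructor
  · linarith [average_le_average_add (D := D) hP (h := h) (α := α) (y := y)
      fun z => show χ z ≤ ψ z + e by linarith [(abs_le.1 (H z)).1]]
  · linarith [average_le_average_add (D := D) hP (h := h) (α := α) (y := y)
      fun z => show ψ z ≤ χ z + e by linarith [(abs_le.1 (H z)).2]]

theorem average_const (hP : 1 ≤ P) (h : ℝ) (α : A) (y : E N) (m : ℝ) :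
    D.average h α y (fun _ => m) = m := by
  have hP' : (P : ℝ) ≠ 0 := by exact_mod_cast (by omega : P ≠ 0)
  simp only [Coeffs.average, Finset.sum_const, Finset.card_univ, Fintype.card_fin, nsmul_eq_mul]
  field_simp
  ring

theorem abs_average_le (hP : 1 ≤ P) {h B : ℝ} {α : A} {y : E N} {ψ : E N → ℝ}
    (H : ∀ z, |ψ z| ≤ B) : |D.average h α y ψ| ≤ B := by
  have := abs_average_sub_le (D := D) hP (h := h) (α := α) (y := y) (ψ := ψ) (χ := fun _ => 0)
    (e := B) (by simpa using H)
  simpa [average_const hP] using this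

theorem average_add_const (hP : 1 ≤ P) (h : ℝ) (α : A) (y : E N) (ψ : E N → ℝ) (m : ℝ) :
    D.average h α y (fun z => ψ z + m) = D.average h α y ψ + m := by
  conv_rhs => rw [← average_const (D := D) hP h α y m]
  simp only [Coeffs.average, ← mul_add, ← Finset.sum_add_distrib]
  congr 1
  exact Finset.sum_congr rfl fun i _ => by ring

end Coefficients

/-! ### A family of schemes that contains both semi-Lagrangian schemes -/

section Blend

variable {A : Type*} {N P M : ℕ} {D : Coeffs A N P} {lam K q θ h : ℝ}

/-- The expression under the supremum in the blended operator. -/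
noncomputable def Coeffs.blendTerm (D : Coeffs A N P) (θ h : ℝ) (α : A) (y : E N) (t : ℝ)
    (ψ : E N → ℝ) : ℝ :=
  -(1 / h) * ((1 - θ * (h * D.c α y)) * D.average h α y ψ - t) + (1 - θ) * (D.c α y * t) - D.f α y

/-- The operator that applies the share `θ` of the zero-order term as a discount factor. -/
noncomputable def Coeffs.blend (D : Coeffs A N P) (θ h : ℝ) (y : E N) (t : ℝ) (ψ : E N → ℝ) : ℝ :=
  ⨆ α, D.blendTerm θ h α y t ψ

/-- The scheme of the blended operator. -/
noncomputable def Coeffs.blendScheme (D : Coeffs A N P) (θ : ℝ) (M : ℕ) (q : ℝ)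
    (κ : ℝ → E N → Fin N → ℤ) (h : ℝ) (x : E N) (t : ℝ) (φ : E N → ℝ) : ℝ :=
  D.blend θ h x t (shift (truncInterp (h ^ q) M (κ (h ^ q)) φ) x)

theorem scheme_eq_blendScheme (κ : ℝ → E N → Fin N → ℤ) :
    D.scheme M q κ = D.blendScheme 0 M q κ := by
  funext h x t φ
  simp only [Coeffs.scheme, Coeffs.hatS, Coeffs.blendScheme, Coeffs.blend, Coeffs.blendTerm]
  congr 1
  funext α
  ring

theorem schemeDisc_eq_blendScheme (κ : ℝ → E N → Fin N → ℤ) :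
    D.schemeDisc M q κ = D.blendScheme 1 M q κ := by
  funext h x t φ
  simp only [Coeffs.schemeDisc, Coeffs.hatSDisc, Coeffs.blendScheme, Coeffs.blend,
    Coeffs.blendTerm]
  congr 1
  funext α
  ring

theorem abs_discount_le [Nonempty A] (hD : D.Bounds lam K) (hθ : θ ∈ Icc (0 : ℝ) 1) (hh : 0 < h)
    (α : A) (x : E N) : |1 - θ * (h * D.c α x)| ≤ 1 + h * K := by
  have h1 : 0 ≤ h * D.c α x := mul_nonneg hh.le (hD.c_nonneg α x)
  have h2 : h * D.c α x ≤ h * K :=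
    mul_le_mul_of_nonneg_left ((le_abs_self _).trans (hD.abs_c_le α x)) hh.le
  have h3 : θ * (h * D.c α x) ≤ h * D.c α x := mul_le_of_le_one_left h1 hθ.2
  have h4 := mul_nonneg hθ.1 h1
  rw [abs_le]
  constructor <;> linarith

theorem abs_blendTerm_le [Nonempty A] (hD : D.Bounds lam K) (hP : 1 ≤ P)
    (hθ : θ ∈ Icc (0 : ℝ) 1) (hh : 0 < h) {B : ℝ} {ψ : E N → ℝ} (hψ : ∀ z, |ψ z| ≤ B)
    (α : A) (x : E N) (t : ℝ) :
    |D.blendTerm θ h α x t ψ| ≤ 1 / h * ((1 + h * K) * B + |t|) + K * |t| + K := by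
  have hK := hD.K_nonneg
  have hB : 0 ≤ B := (abs_nonneg _).trans (hψ 0)
  have h1 : |(1 - θ * (h * D.c α x)) * D.average h α x ψ| ≤ (1 + h * K) * B := by
    rw [abs_mul]
    exact mul_le_mul (abs_discount_le hD hθ hh α x) (abs_average_le hP hψ) (abs_nonneg _)
      (by positivity)
  have h2 : |-(1 / h) * ((1 - θ * (h * D.c α x)) * D.average h α x ψ - t)| ≤
      1 / h * ((1 + h * K) * B + |t|) := by
    rw [abs_mul, abs_neg, abs_of_pos (by positivity : 0 < 1 / h)]
    refine mul_le_mul_of_nonneg_left ((abs_sub _ _).trans ?_) (by positivity)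
    linarith
  have h3 : |(1 - θ) * (D.c α x * t)| ≤ K * |t| := by
    rw [abs_mul, abs_mul]
    have e1 : |1 - θ| ≤ 1 := by rw [abs_le]; constructor <;> linarith [hθ.1, hθ.2]
    have e2 := mul_le_mul_of_nonneg_right (hD.abs_c_le α x) (abs_nonneg t)
    exact (mul_le_of_le_one_left (by positivity) e1).trans e2
  unfold Coeffs.blendTerm
  refine (abs_sub _ _).trans (add_le_add ((abs_add_le _ _).trans (add_le_add h2 h3))
    (hD.abs_f_le α x))

theorem abs_shift_truncInterp_le {φ : E N → ℝ} {B : ℝ} (hB : ∀ x, |φ x| ≤ B) (δ : ℝ) (M : ℕ)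
    (κ : E N → Fin N → ℤ) (x z : E N) : |shift (truncInterp δ M κ φ) x z| ≤ B :=
  abs_truncInterp_le hB δ M κ (x + z)

theorem bddAbove_blendTerm [Nonempty A] (hD : D.Bounds lam K) (hP : 1 ≤ P)
    (hθ : θ ∈ Icc (0 : ℝ) 1) (hh : 0 < h) {B : ℝ} {ψ : E N → ℝ} (hψ : ∀ z, |ψ z| ≤ B)
    (x : E N) (t : ℝ) : BddAbove (range fun α => D.blendTerm θ h α x t ψ) := by
  refine ⟨1 / h * ((1 + h * K) * B + |t|) + K * |t| + K, ?_⟩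
  rintro _ ⟨α, rfl⟩
  exact (le_abs_self _).trans (abs_blendTerm_le hD hP hθ hh hψ α x t)

/-- Splits the variation into those of the average, of `t`, of `c` and of `f`, with factors
independent of the control. It serves continuity both in `r` and in `x`. -/
theorem abs_blendTerm_sub_le [Nonempty A] (hD : D.Bounds lam K) (hP : 1 ≤ P)
    (hθ : θ ∈ Icc (0 : ℝ) 1) (hh : 0 < h) {B : ℝ} {ψ χ : E N → ℝ} (hχ : ∀ z, |χ z| ≤ B)
    (α : A) (x y : E N) (s t : ℝ) :
    |D.blendTerm θ h α x s ψ - D.blendTerm θ h α y t χ| ≤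
      (1 / h + K) * |D.average h α x ψ - D.average h α y χ| + (1 / h + K) * |s - t| +
      (B + |t|) * |D.c α x - D.c α y| + |D.f α x - D.f α y| := by
  have hK := hD.K_nonneg
  have e : D.blendTerm θ h α x s ψ - D.blendTerm θ h α y t χ =
      -(1 / h * (1 - θ * (h * D.c α x))) * (D.average h α x ψ - D.average h α y χ) +
      θ * D.average h α y χ * (D.c α x - D.c α y) +
      (1 / h + (1 - θ) * D.c α x) * (s - t) + (1 - θ) * t * (D.c α x - D.c α y) -
      (D.f α x - D.f α y) := by
    unfold Coeffs.blendTerm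
    field_simp
    ring
  have hθ' : 0 ≤ 1 - θ := by linarith [hθ.2]
  have h1 : |-(1 / h * (1 - θ * (h * D.c α x))) * (D.average h α x ψ - D.average h α y χ)| ≤
      (1 / h + K) * |D.average h α x ψ - D.average h α y χ| := by
    rw [abs_mul, abs_neg, abs_mul, abs_of_pos (by positivity : 0 < 1 / h)]
    refine mul_le_mul_of_nonneg_right ?_ (abs_nonneg _)
    calc 1 / h * |1 - θ * (h * D.c α x)| ≤ 1 / h * (1 + h * K) :=
          mul_le_mul_of_nonneg_left (abs_discount_le hD hθ hh α x) (by positivity)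
      _ = 1 / h + K := by field_simp
  have h2 : |θ * D.average h α y χ * (D.c α x - D.c α y)| ≤ B * |D.c α x - D.c α y| := by
    rw [abs_mul, abs_mul, abs_of_nonneg hθ.1]
    refine mul_le_mul_of_nonneg_right ?_ (abs_nonneg _)
    exact (mul_le_of_le_one_left (abs_nonneg _) hθ.2).trans (abs_average_le hP hχ)
  have h3 : |(1 / h + (1 - θ) * D.c α x) * (s - t)| ≤ (1 / h + K) * |s - t| := by
    have hc := hD.c_nonneg α x
    rw [abs_mul, abs_of_nonneg (by positivity)]
    refine mul_le_mul_of_nonneg_right (add_le_add le_rfl ?_) (abs_nonneg _)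
    exact (mul_le_of_le_one_left hc (by linarith [hθ.1])).trans
      ((le_abs_self _).trans (hD.abs_c_le α x))
  have h4 : |(1 - θ) * t * (D.c α x - D.c α y)| ≤ |t| * |D.c α x - D.c α y| := by
    rw [abs_mul, abs_mul, abs_of_nonneg hθ']
    refine mul_le_mul_of_nonneg_right ?_ (abs_nonneg _)
    exact mul_le_of_le_one_left (abs_nonneg _) (by linarith [hθ.1])
  rw [e]
  refine (abs_sub _ _).trans ?_
  refine (add_le_add ((abs_add_le _ _).trans (add_le_add ((abs_add_le _ _).trans
    (add_le_add ((abs_add_le _ _).trans (add_le_add h1 h2)) h3)) h4)) le_rfl).trans_eq ?_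
  ring

/-! ### Monotonicity -/

/-- Here the restriction on `h` enters: the average must be multiplied by a number in `[0, 1]` for
the order to survive without enlarging `e`. -/
theorem blendTerm_le_add (hP : 1 ≤ P) (hh : 0 < h) {α : A} {x : E N}
    (hc : 0 ≤ θ * (h * D.c α x)) (hc1 : θ * (h * D.c α x) ≤ 1) {e : ℝ} (he : 0 ≤ e)
    {ψ χ : E N → ℝ} (H : ∀ z, χ z ≤ ψ z + e) (t : ℝ) :
    D.blendTerm θ h α x t ψ ≤ D.blendTerm θ h α x t χ + e / h := by
  have h1 := average_le_average_add (D := D) hP (h := h) (α := α) (y := x) H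
  have h2 : (1 - θ * (h * D.c α x)) * (D.average h α x χ - D.average h α x ψ) ≤ e :=
    (mul_le_mul_of_nonneg_left (by linarith : _ ≤ e) (by linarith)).trans
      (mul_le_of_le_one_left he (by linarith))
  have h3 := div_le_div_of_nonneg_right h2 hh.le
  unfold Coeffs.blendTerm
  have e1 : -(1 / h) * ((1 - θ * (h * D.c α x)) * D.average h α x ψ - t) =
      -(1 / h) * ((1 - θ * (h * D.c α x)) * D.average h α x χ - t) +
      (1 - θ * (h * D.c α x)) * (D.average h α x χ - D.average h α x ψ) / h := by
    field_simp
    ring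
  linarith

theorem blendScheme_le_add [Nonempty A] (hD : D.Bounds lam K) (hP : 1 ≤ P)
    (hθ : θ ∈ Icc (0 : ℝ) 1) (κ : ℝ → E N → Fin N → ℤ) (hh : 0 < h)
    (hc : ∀ α x, θ * (h * D.c α x) ≤ 1) {w v : E N → ℝ} (hw : supNorm w < ⊤) (hwv : w ≤ v)
    {L : ℝ} (hL : 0 ≤ L)
    (hlip : (∀ y z, |w y - w z| ≤ L * ‖y - z‖) ∨ (∀ y z, |v y - v z| ≤ L * ‖y - z‖))
    (x : E N) (r : ℝ) :
    D.blendScheme θ M q κ h x r v ≤ D.blendScheme θ M q κ h x r w + √N * L * h ^ (q - 1) := by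
  have hδ : 0 < h ^ q := Real.rpow_pos_of_pos hh q
  obtain ⟨B, -, hB⟩ := exists_abs_le hw
  refine ciSup_le_ciSup_add (bddAbove_blendTerm hD hP hθ hh
    (abs_shift_truncInterp_le hB _ _ _ _) x r) fun α => ?_
  have h0 : 0 ≤ θ * (h * D.c α x) := mul_nonneg hθ.1 (mul_nonneg hh.le (hD.c_nonneg α x))
  have H : ∀ z, shift (truncInterp (h ^ q) M (κ (h ^ q)) w) x z ≤
      shift (truncInterp (h ^ q) M (κ (h ^ q)) v) x z + L * (√N * h ^ q) :=
    fun z => meshTrunc_le_add hδ _ hL hwv hlip _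
  refine (blendTerm_le_add hP hh h0 (hc α x) (by positivity) H r).trans_eq ?_
  rw [Real.rpow_sub_one hh.ne']
  ring

theorem epsMonotone_blendScheme [Nonempty A] (hD : D.Bounds lam K) (hP : 1 ≤ P)
    (hθ : θ ∈ Icc (0 : ℝ) 1) (κ : ℝ → E N → Fin N → ℤ) {H : Set ℝ}
    (hH : ∀ h ∈ H, 0 < h ∧ ∀ α x, θ * (h * D.c α x) ≤ 1) :
    EpsMonotone H (q - 1) (√N) (D.blendScheme θ M q κ) := by
  refine ⟨lam, hD.lam_pos, ?_, ?_, ?_⟩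
  · intro h hh x r w v hw _ hwv
    exact blendScheme_le_add hD hP hθ κ (hH h hh).1 (hH h hh).2 hw.supNorm_lt_top hwv
      ENNReal.toReal_nonneg (Or.inl hw.abs_sub_le) x r
  · intro h hh x r w v hw hv hwv
    exact blendScheme_le_add hD hP hθ κ (hH h hh).1 (hH h hh).2 hw.2 hwv
      ENNReal.toReal_nonneg (Or.inr hv.abs_sub_le) x r
  · intro h hh x r m u hm hu
    have h0 := (hH h hh).1
    obtain ⟨B, -, hB⟩ := exists_abs_le hu.2
    have hshift : shift (truncInterp (h ^ q) M (κ (h ^ q)) fun z => u z + m) x =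
        fun z => shift (truncInterp (h ^ q) M (κ (h ^ q)) u) x z + m :=
      funext fun z => meshTrunc_add_const _ _ _ _
    have hB' : ∀ z, |u z + m| ≤ B + |m| := fun z =>
      (abs_add_le _ _).trans (add_le_add (hB z) le_rfl)
    have key := ciSup_le_ciSup_add (C := -(lam * m)) (f := fun α => D.blendTerm θ h α x r
      (shift (truncInterp (h ^ q) M (κ (h ^ q)) u) x)) (bddAbove_blendTerm hD hP hθ h0
      (abs_shift_truncInterp_le hB' (h ^ q) M (κ (h ^ q)) x) x (r + m)) fun α => ?_
    · unfold Coeffs.blendScheme Coeffs.blend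
      linarith
    · rw [hshift]
      unfold Coeffs.blendTerm
      rw [average_add_const hP]
      have h1 := mul_le_mul_of_nonneg_right (hD.lam_le α x) hm
      -- Raising everything by `m` yields `θ * (c * m)` from the discount and `(1 - θ) * (c * m)`
      -- from the explicit term: in total `c * m ≥ lam * m`, for every `θ`.
      have e : ∀ a c : ℝ, -(1 / h) * ((1 - θ * (h * c)) * (a + m) - (r + m)) =
          -(1 / h) * ((1 - θ * (h * c)) * a - r) + θ * (c * m) := by
        intro a c
        field_simp
        ring
      rw [e]
      linarith

/-! ### Regularity -/

theorem regular_blendScheme [Nonempty A] (hD : D.Bounds lam K) (hP : 1 ≤ P)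
    (hθ : θ ∈ Icc (0 : ℝ) 1) (κ : ℝ → E N → Fin N → ℤ) :
    Regular (Ioi 0) (fun h => grid N (h ^ q) M) (D.blendScheme θ M q κ) := by
  intro h hh φ hφ
  have hh : 0 < h := hh
  have hK := hD.K_nonneg
  obtain ⟨B, hB0, hB⟩ := exists_abs_le hφ.2
  refine ⟨⟨1 / h * ((1 + h * K) * B + B) + K * B + K, fun x => ?_⟩,
    continuousOn_grid (Real.rpow_pos_of_pos hh q) _, fun R ε hε => ?_⟩
  · refine abs_ciSup_le fun α => (abs_blendTerm_le hD hP hθ hh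
      (abs_shift_truncInterp_le hB _ _ _ _) α x (φ x)).trans ?_
    have := hB x
    gcongr
  · refine ⟨ε / 2 / (1 / h + K), by positivity, fun x r s _ _ hrs => ?_⟩
    refine lt_of_le_of_lt (b := ε / 2) ?_ (half_lt_self hε)
    refine abs_ciSup_sub_le (bddAbove_blendTerm hD hP hθ hh
      (abs_shift_truncInterp_le hB _ _ _ _) x s) fun α => ?_
    refine (abs_blendTerm_sub_le hD hP hθ hh (abs_shift_truncInterp_le hB _ _ _ _)
      α x x r s).trans ?_
    simp only [sub_self, abs_zero, mul_zero, zero_add, add_zero]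
    rw [lt_div_iff₀ (by positivity)] at hrs
    linarith

/-- No common Lipschitz bound is assumed for `c`; uniformity in the control comes from joint
continuity and compactness. -/
theorem eventually_abs_c_sub_le [TopologicalSpace A] [CompactSpace A] (hcont : D.IsContinuous)
    (x : E N) {ε : ℝ} (hε : 0 < ε) : ∀ᶠ y in 𝓝 x, ∀ α, |D.c α y - D.c α x| ≤ ε := by
  have := (isCompact_univ (X := A)).eventually_forall_of_forall_eventually (x₀ := x)
    (P := fun y α => |D.c α y - D.c α x| ≤ ε) fun α _ => ?_
  · simpa using this
  · have h : Continuous fun z : E N × A => |D.c z.2 z.1 - D.c z.2 x| :=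
      (hcont.c.sub (hcont.c.comp (continuous_const.prodMk continuous_snd))).abs
    have h2 := h.tendsto (x, α)
    simp only [sub_self, abs_zero] at h2
    exact (h2.eventually (gt_mem_nhds hε)).mono fun z hz => le_of_lt hz

theorem eventually_abs_f_sub_le [Nonempty A] (hD : D.Bounds lam K) (x : E N) {ε : ℝ}
    (hε : 0 < ε) : ∀ᶠ y in 𝓝 x, ∀ α, |D.f α y - D.f α x| ≤ ε := by
  have h : Continuous fun y : E N => K * ‖y - x‖ := by fun_prop
  have h2 := h.tendsto x
  simp only [sub_self, norm_zero, mul_zero] at h2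
  exact (h2.eventually (gt_mem_nhds hε)).mono fun y hy α =>
    (hD.abs_f_sub_le α y x).trans (le_of_lt hy)

theorem eventually_abs_average_sub_le [Nonempty A] (hD : D.Bounds lam K) (hP : 1 ≤ P)
    (hh : 0 < h) {T : E N → ℝ} (hT : Continuous T) (x : E N) {ε : ℝ} (hε : 0 < ε) :
    ∀ᶠ y in 𝓝 x, ∀ α, |D.average h α y (shift T y) - D.average h α x (shift T x)| ≤ ε := by
  have hK := hD.K_nonneg
  set s := √(h * P)
  -- Bounds all displacements and also their Lipschitz constant in the base point. Evaluation points
  -- thus stay in a compact ball, where `T` is uniformly continuous, and move by at most `(1 + R) *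
  -- ‖y - x‖`.
  set R := h * K + s * K
  have hs : 0 ≤ s := Real.sqrt_nonneg _
  obtain ⟨δ, hδ, hu⟩ := Metric.uniformContinuousOn_iff.1
    ((isCompact_closedBall x (R + 1)).uniformContinuousOn_of_continuous hT.continuousOn) ε hε
  have hc : Continuous fun y : E N => (1 + R) * ‖y - x‖ := by fun_prop
  have hc2 := hc.tendsto x
  simp only [sub_self, norm_zero, mul_zero] at hc2
  filter_upwards [hc2.eventually (gt_mem_nhds hδ), Metric.ball_mem_nhds x one_pos] with y hy hy1 α
  have hbd : ∀ y : E N, ∀ i, ‖h • D.b α y + s • D.col α y i‖ ≤ R ∧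
      ‖h • D.b α y - s • D.col α y i‖ ≤ R := by
    intro y i
    have h1 : ‖h • D.b α y‖ ≤ h * K := by
      rw [norm_smul, Real.norm_of_nonneg hh.le]
      exact mul_le_mul_of_nonneg_left (hD.norm_b_le α y) hh.le
    have h2 : ‖s • D.col α y i‖ ≤ s * K := by
      rw [norm_smul, Real.norm_of_nonneg hs]
      exact mul_le_mul_of_nonneg_left (hD.norm_col_le α y i) hs
    exact ⟨(norm_add_le _ _).trans (add_le_add h1 h2), (norm_sub_le _ _).trans (add_le_add h1 h2)⟩
  have hb : ‖h • D.b α y - h • D.b α x‖ ≤ h * K * ‖y - x‖ := by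
    rw [← smul_sub, norm_smul, Real.norm_of_nonneg hh.le, mul_assoc]
    exact mul_le_mul_of_nonneg_left (hD.norm_b_sub_le α y x) hh.le
  have hcol : ∀ i, ‖s • D.col α y i - s • D.col α x i‖ ≤ s * K * ‖y - x‖ := by
    intro i
    rw [← smul_sub, norm_smul, Real.norm_of_nonneg hs, mul_assoc]
    exact mul_le_mul_of_nonneg_left (hD.norm_col_sub_le α y x i) hs
  have hT' : ∀ z z' : E N, ‖z‖ ≤ R → ‖z'‖ ≤ R → ‖z - z'‖ ≤ R * ‖y - x‖ →
      |T (y + z) - T (x + z')| ≤ ε := by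
    intro z z' hz hz' hzz
    rw [Metric.mem_ball, dist_eq_norm] at hy1
    refine (hu (y + z) ?_ (x + z') ?_ ?_).le
    · rw [mem_closedBall_iff_norm, add_sub_right_comm]
      linarith [norm_add_le (y - x) z]
    · rw [mem_closedBall_iff_norm, add_sub_cancel_left]
      linarith
    · rw [dist_eq_norm, add_sub_add_comm]
      linarith [norm_add_le (y - x) (z - z')]
  rw [average_sub]
  refine abs_mean_le hP fun i => ?_
  rw [add_sub_add_comm, two_mul]
  refine (abs_add_le _ _).trans (add_le_add ?_ ?_)
  · refine hT' _ _ (hbd y i).1 (hbd x i).1 ?_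
    rw [add_sub_add_comm]
    refine (norm_add_le _ _).trans ((add_le_add hb (hcol i)).trans_eq (by ring))
  · refine hT' _ _ (hbd y i).2 (hbd x i).2 ?_
    rw [sub_sub_sub_comm]
    refine (norm_sub_le _ _).trans ((add_le_add hb (hcol i)).trans_eq (by ring))

theorem continuous_blendScheme [TopologicalSpace A] [CompactSpace A] [Nonempty A]
    (hcont : D.IsContinuous) (hD : D.Bounds lam K) (hP : 1 ≤ P) (hθ : θ ∈ Icc (0 : ℝ) 1)
    (κ : ℝ → E N → Fin N → ℤ) (hh : 0 < h) {φ : E N → ℝ} (hφ : MemCb φ)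
    (hT : Continuous (truncInterp (h ^ q) M (κ (h ^ q)) φ)) :
    Continuous fun x => D.blendScheme θ M q κ h x (φ x) φ := by
  have hK := hD.K_nonneg
  obtain ⟨B, hB0, hB⟩ := exists_abs_le hφ.2
  rw [continuous_iff_continuousAt]
  intro x
  rw [ContinuousAt, Metric.tendsto_nhds]
  intro ε hε
  -- The sum of the factors in `abs_blendTerm_sub_le` when both `φ` and the interpolant are bounded
  -- by `B`.
  set Q := 2 * (1 / h + K) + (2 * B + 1) with hQ
  have hQ0 : 0 < Q := by positivity
  have hη : 0 < ε / 2 / Q := by positivity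
  have hφx : ∀ᶠ y in 𝓝 x, |φ y - φ x| ≤ ε / 2 / Q :=
    ((Metric.tendsto_nhds.1 (hφ.1.tendsto x)) _ hη).mono fun y hy => le_of_lt hy
  filter_upwards [eventually_abs_c_sub_le hcont x hη, eventually_abs_f_sub_le hD x hη,
    eventually_abs_average_sub_le hD hP hh hT x hη, hφx] with y hc hf ha hp
  rw [Real.dist_eq]
  refine lt_of_le_of_lt (b := ε / 2) ?_ (half_lt_self hε)
  refine abs_ciSup_sub_le (bddAbove_blendTerm hD hP hθ hh
    (abs_shift_truncInterp_le hB _ _ _ _) x (φ x)) fun α => ?_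
  refine (abs_blendTerm_sub_le hD hP hθ hh (abs_shift_truncInterp_le hB _ _ _ _)
    α y x (φ y) (φ x)).trans ?_
  calc _ ≤ (1 / h + K) * (ε / 2 / Q) + (1 / h + K) * (ε / 2 / Q) + (B + B) * (ε / 2 / Q) +
        ε / 2 / Q := by
        have h1 := ha α
        have h2 := hc α
        have h3 := hf α
        have h4 := hB x
        gcongr
    _ = Q * (ε / 2 / Q) := by rw [hQ]; ring
    _ = ε / 2 := by field_simp

theorem continuous_truncInterp_of_eq_one (hN : N = 1) {δ : ℝ} (hδ : 0 < δ)
    {κ : E N → Fin N → ℤ} (hκ : IsMeshSelection δ κ) (v : E N → ℝ) :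
    Continuous (truncInterp δ M κ v) := by
  subst hN
  exact continuous_truncInterp_line hδ hκ v

end Blend

/-! ### Consistency -/

section Consistency

variable {A : Type*} {N P M : ℕ} {D : Coeffs A N P} {lam K q θ h : ℝ}

theorem inner_gradient_eq (φ : E N → ℝ) (x v : E N) :
    inner ℝ v (gradient φ x) = fderiv ℝ φ x v := by
  rw [real_inner_comm, gradient, InnerProductSpace.toDual_symm_apply]

theorem norm_fderiv_eq (φ : E N → ℝ) (x : E N) :
    ‖fderiv ℝ φ x‖ = ‖iteratedFDeriv ℝ 1 φ x‖ := (norm_iteratedFDeriv_one φ).symm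

/-- Expressing the diffusion through the columns of σ matches it with the directional second
differences of the scheme. -/
theorem trace_a_mul_hessian (α : A) (x : E N) (φ : E N → ℝ) :
    (D.a α x * hessian φ x).trace =
      1 / 2 * ∑ i, fderiv ℝ (fderiv ℝ φ) x (D.col α x i) (D.col α x i) := by
  have hcol : ∀ i, D.col α x i = ∑ k, D.σ α x k i • EuclideanSpace.single k (1 : ℝ) := by
    intro i
    ext l
    simp [Coeffs.col, Finset.sum_apply, Pi.single_apply]
  have h1 : ∀ i, fderiv ℝ (fderiv ℝ φ) x (D.col α x i) (D.col α x i) =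
      ∑ k, ∑ l, D.σ α x k i * D.σ α x l i * hessian φ x k l := by
    intro i
    rw [hcol]
    simp only [map_sum, map_smul, sum_apply, smul_apply, hessian, Matrix.of_apply,
      iteratedFDeriv_two_apply, Matrix.cons_val_zero, Matrix.cons_val_one, smul_eq_mul,
      Finset.mul_sum]
    rw [Finset.sum_comm]
    refine Finset.sum_congr rfl fun k _ => Finset.sum_congr rfl fun l _ => ?_
    ring
  simp only [h1, Coeffs.a, Matrix.smul_mul, Matrix.trace_smul, smul_eq_mul]
  congr 1
  simp only [Matrix.trace, Matrix.diag_apply, Matrix.mul_apply, Matrix.transpose_apply,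
    Finset.sum_mul]
  rw [Finset.sum_comm]
  conv_rhs => rw [Finset.sum_comm]
  refine Finset.sum_congr rfl fun k _ => ?_
  rw [Finset.sum_comm]
  refine Finset.sum_congr rfl fun i _ => Finset.sum_congr rfl fun l _ => ?_
  ring

theorem abs_trace_a_mul_hessian_le [Nonempty A] (hD : D.Bounds lam K) {φ : E N → ℝ} {x : E N}
    {B : ℝ} (hB : ‖iteratedFDeriv ℝ 2 φ x‖ ≤ B) (α : A) :
    |(D.a α x * hessian φ x).trace| ≤ P * K ^ 2 * B := by
  have hK := hD.K_nonneg
  have hB0 : 0 ≤ B := (norm_nonneg _).trans hB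
  rw [← norm_fderiv_fderiv] at hB
  rw [trace_a_mul_hessian, abs_mul]
  have h1 : |∑ i, fderiv ℝ (fderiv ℝ φ) x (D.col α x i) (D.col α x i)| ≤
      ∑ _i : Fin P, B * K * K := by
    refine (Finset.abs_sum_le_sum_abs _ _).trans (Finset.sum_le_sum fun i _ => ?_)
    refine (ContinuousLinearMap.le_opNorm₂ (fderiv ℝ (fderiv ℝ φ) x) _ _).trans ?_
    have := hD.norm_col_le α x i
    gcongr
  simp only [Finset.sum_const, Finset.card_univ, Fintype.card_fin, nsmul_eq_mul] at h1
  have h2 : |(1 / 2 : ℝ)| ≤ 1 := by norm_num [abs_of_pos]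
  refine (mul_le_of_le_one_left (abs_nonneg _) h2).trans (h1.trans_eq (by ring))

/-- The average of a smooth function is a weak Euler step of its generator. -/
theorem abs_average_shift_sub_le [Nonempty A] (hD : D.Bounds lam K) (hP : 1 ≤ P) (hh : 0 < h)
    {φ : E N → ℝ} (hφ : ContDiff ℝ ∞ φ) {B C : ℝ} (hB : ∀ x, ‖iteratedFDeriv ℝ 2 φ x‖ ≤ B)
    (hC : ∀ x, ‖iteratedFDeriv ℝ 4 φ x‖ ≤ C) (α : A) (x : E N) :
    |D.average h α x (shift φ x) - φ x -
      h * ((D.a α x * hessian φ x).trace + fderiv ℝ φ x (D.b α x))| ≤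
      h ^ 2 * (P ^ 2 * K ^ 4 + P * K ^ 3 + K ^ 2) * (B + C) := by
  have hK := hD.K_nonneg
  have hB0 : 0 ≤ B := (norm_nonneg _).trans (hB x)
  have hC0 : 0 ≤ C := (norm_nonneg _).trans (hC x)
  have hP' : (0 : ℝ) < P := by exact_mod_cast hP
  have hs : √(h * P) * √(h * P) = h * P := Real.mul_self_sqrt (by positivity)
  -- Squaring `√(h * P)` gives `h * P`, whose `P` cancels that of `1 / (2 * P)`: the quadratic terms
  -- average exactly to `h` times the trace.
  have e : D.average h α x (shift φ x) - φ x -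
      h * ((D.a α x * hessian φ x).trace + fderiv ℝ φ x (D.b α x)) =
      1 / (2 * P : ℝ) * ∑ i : Fin P,
        (φ (x + (h • D.b α x + √(h * P) • D.col α x i)) +
          φ (x + (h • D.b α x - √(h * P) • D.col α x i)) - 2 * φ x -
          2 * fderiv ℝ φ x (h • D.b α x) -
          fderiv ℝ (fderiv ℝ φ) x (√(h * P) • D.col α x i) (√(h * P) • D.col α x i)) := by
    rw [trace_a_mul_hessian]
    simp only [Coeffs.average, shift, map_smul, smul_apply, smul_eq_mul, ← mul_assoc, hs,
      Finset.sum_sub_distrib, Finset.sum_const, Finset.card_univ, Fintype.card_fin, nsmul_eq_mul,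
      ← Finset.mul_sum]
    field_simp
    ring
  rw [e]
  refine abs_mean_le hP fun i => (abs_euler_step_sub_le hφ hB hC _ _ _).trans ?_
  have hy : ‖h • D.b α x‖ ≤ h * K := by
    rw [norm_smul, Real.norm_of_nonneg hh.le]
    exact mul_le_mul_of_nonneg_left (hD.norm_b_le α x) hh.le
  have hz : ‖√(h * P) • D.col α x i‖ ^ 2 ≤ h * P * K ^ 2 := by
    rw [norm_smul, mul_pow, Real.norm_of_nonneg (Real.sqrt_nonneg _), pow_two √(h * P), hs]
    have := hD.norm_col_le α x i
    gcongr
  have hz4 : ‖√(h * P) • D.col α x i‖ ^ 4 ≤ (h * P * K ^ 2) ^ 2 := by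
    rw [show (4 : ℕ) = 2 * 2 from rfl, pow_mul]
    gcongr
  calc _ ≤ 2 * C * (h * P * K ^ 2) ^ 2 + (2 * B + C) * (h * K) * (h * P * K ^ 2) +
        2 * (B * (h * K) ^ 2) := by gcongr
    _ = 2 * (h ^ 2 * (P ^ 2 * K ^ 4 + P * K ^ 3 + K ^ 2) * (B + C)) -
        h ^ 2 * (2 * B * (P ^ 2 * K ^ 4) + C * (P * K ^ 3) + 2 * C * K ^ 2) := by ring
    _ ≤ _ := sub_le_self _ (by positivity)

/-- On `(0, h₀]` a larger exponent is dominated by a smaller one, at the price of a power of `h₀`.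
-/
theorem exists_rpow_bound (q h₀ : ℝ) : ∃ C : ℝ, 1 ≤ C ∧ ∀ h ∈ Ioc 0 h₀,
    h ≤ C * h ^ min (2 * q - 1) 1 ∧ h ^ (2 * q - 1) ≤ C * h ^ min (2 * q - 1) 1 := by
  have key : ∀ p s : ℝ, s ≤ p → ∀ h ∈ Ioc 0 h₀, h ^ p ≤ h₀ ^ (p - s) * h ^ s := by
    intro p s hs h hh
    calc h ^ p = h ^ (p - s) * h ^ s := by rw [← Real.rpow_add hh.1, sub_add_cancel]
      _ ≤ h₀ ^ (p - s) * h ^ s := mul_le_mul_of_nonneg_right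
          (Real.rpow_le_rpow hh.1.le hh.2 (sub_nonneg.2 hs)) (Real.rpow_nonneg hh.1.le _)
  set s := min (2 * q - 1) 1
  refine ⟨max 1 (max (h₀ ^ (1 - s)) (h₀ ^ (2 * q - 1 - s))), le_max_left _ _, fun h hh => ?_⟩
  have hs : 0 ≤ h ^ s := Real.rpow_nonneg hh.1.le _
  constructor
  · have := key 1 s (min_le_right _ _) h hh
    rw [Real.rpow_one] at this
    exact this.trans (mul_le_mul_of_nonneg_right
      (le_max_of_le_right (le_max_left _ _)) hs)
  · exact (key _ s (min_le_left _ _) h hh).trans (mul_le_mul_of_nonneg_right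
      (le_max_of_le_right (le_max_right _ _)) hs)

/-- The first derivative is bounded only at `x` and carries the weight `θ`, so that for `θ = 0` no
global bound on it is needed. -/
theorem exists_abs_F_sub_blendScheme_le [Nonempty A] (hD : D.Bounds lam K) (hP : 1 ≤ P) (M : ℕ)
    (q : ℝ) (κ : ℝ → E N → Fin N → ℤ) (hκ : ∀ δ > 0, IsMeshSelection δ (κ δ))
    (hθ : θ ∈ Icc (0 : ℝ) 1) {h₀ : ℝ} (hh₀ : 0 < h₀) :
    ∃ C : ℝ, 0 < C ∧ ∀ h ∈ Ioc 0 h₀, ∀ (x : E N) (φ : E N → ℝ), ContDiff ℝ ∞ φ →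
      ∀ M₁ M₂ M₄ : ℝ, ‖iteratedFDeriv ℝ 1 φ x‖ ≤ M₁ → (∀ y, ‖iteratedFDeriv ℝ 2 φ y‖ ≤ M₂) →
      (∀ y, ‖iteratedFDeriv ℝ 4 φ y‖ ≤ M₄) →
      |D.F x (φ x) (gradient φ x) (hessian φ x) - D.blendScheme θ M q κ h x (φ x) φ| ≤
        C * (θ * (h * M₁) + (h ^ min (2 * q - 1) 1 * M₂ + h * M₄)) := by
  have hK := hD.K_nonneg
  obtain ⟨C₀, hC₀, hpow⟩ := exists_rpow_bound q h₀
  obtain ⟨C₂, hC₂, herr⟩ := exists_truncInterp_error N M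
  set C₁ : ℝ := P ^ 2 * K ^ 4 + P * K ^ 3 + K ^ 2 with hC₁def
  have hC₁ : 0 ≤ C₁ := by positivity
  set C₃ := (C₁ + C₂) * C₀ with hC₃def
  have hC₃ : 0 ≤ C₃ := by positivity
  -- `C₃` bounds the combined Euler and interpolation error. The terms with `K * h₀`, `K * (P * K ^
  -- 2)` and `K * K` come from the discount acting on this error, on the diffusion and on the drift;
  -- the final 1 ensures positivity.
  refine ⟨C₃ * (1 + K * h₀) + K * (P * K ^ 2) * C₀ + K * K + 1, by positivity, ?_⟩
  intro h hh x φ hφ M₁ M₂ M₄ h1 h2 h4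
  have hh0 : 0 < h := hh.1
  have hM₁ : 0 ≤ M₁ := (norm_nonneg _).trans h1
  have hM₂ : 0 ≤ M₂ := (norm_nonneg _).trans (h2 x)
  have hM₄ : 0 ≤ M₄ := (norm_nonneg _).trans (h4 x)
  obtain ⟨hp1, hp2⟩ := hpow h hh
  set m := h ^ min (2 * q - 1) 1
  have hm : 0 ≤ m := Real.rpow_nonneg hh0.le _
  have hδ : 0 < h ^ q := Real.rpow_pos_of_pos hh0 q
  have hδ2 : (h ^ q) ^ 2 = h * h ^ (2 * q - 1) := by
    rw [Real.rpow_sub_one hh0.ne', mul_div_cancel₀ _ hh0.ne', mul_comm 2 q, Real.rpow_mul hh0.le]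
    norm_num
  have hL : ∀ α, |(D.a α x * hessian φ x).trace + fderiv ℝ φ x (D.b α x)| ≤
      P * K ^ 2 * M₂ + K * M₁ := by
    intro α
    refine (abs_add_le _ _).trans (add_le_add (abs_trace_a_mul_hessian_le hD (h2 x) α) ?_)
    rw [← norm_fderiv_eq] at h1
    refine (ContinuousLinearMap.le_opNorm (fderiv ℝ φ x) _).trans ?_
    rw [mul_comm]
    have := hD.norm_b_le α x
    gcongr
  have hterm : ∀ α, |(-(D.a α x * hessian φ x).trace - inner ℝ (D.b α x) (gradient φ x) +
      D.c α x * φ x - D.f α x) - D.blendTerm θ h α x (φ x)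
        (shift (truncInterp (h ^ q) M (κ (h ^ q)) φ) x)| ≤
      (C₃ * (1 + K * h₀) + K * (P * K ^ 2) * C₀ + K * K + 1) *
        (θ * (h * M₁) + (m * M₂ + h * M₄)) := by
    intro α
    have hLα := hL α
    set L := (D.a α x * hessian φ x).trace + fderiv ℝ φ x (D.b α x) with hLdef
    set Avg := D.average h α x (shift (truncInterp (h ^ q) M (κ (h ^ q)) φ) x) with hAvg
    set R := (Avg - φ x) / h - L with hR
    have hRle : |R| ≤ C₃ * (m * M₂ + h * M₄) := by
      have e1 := abs_average_shift_sub_le hD hP hh0 hφ h2 h4 α x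
      have e2 : |Avg - D.average h α x (shift φ x)| ≤ C₂ * (h ^ q) ^ 2 * M₂ :=
        abs_average_sub_le hP fun z => herr (h ^ q) _ φ M₂ hδ (hκ _ hδ) hφ h2 (x + z)
      have e3 : |h * R| ≤ C₂ * (h ^ q) ^ 2 * M₂ + h ^ 2 * C₁ * (M₂ + M₄) := by
        have : h * R = (Avg - D.average h α x (shift φ x)) +
            (D.average h α x (shift φ x) - φ x - h * L) := by
          rw [hR]
          field_simp
          ring
        rw [this]
        exact (abs_add_le _ _).trans (add_le_add e2 e1)
      rw [abs_mul, abs_of_pos hh0, hδ2] at e3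
      have e4 : h * |R| ≤ h * (C₂ * h ^ (2 * q - 1) * M₂ + h * C₁ * (M₂ + M₄)) :=
        e3.trans_eq (by ring)
      refine (le_of_mul_le_mul_left e4 hh0).trans ?_
      calc C₂ * h ^ (2 * q - 1) * M₂ + h * C₁ * (M₂ + M₄)
          = C₂ * h ^ (2 * q - 1) * M₂ + h * C₁ * M₂ + C₁ * (h * M₄) * 1 := by ring
        _ ≤ C₂ * (C₀ * m) * M₂ + C₀ * m * C₁ * M₂ + (C₁ + C₂) * (h * M₄) * C₀ := by
            have : C₁ ≤ C₁ + C₂ := by linarith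
            gcongr
        _ = C₃ * (m * M₂ + h * M₄) := by rw [hC₃def]; ring
    -- Since `Avg - φ x = h * (L + R)`, replacing `φ x` by the average in the discounted share costs
    -- exactly `θ * c * h * (L + R)`.
    have e : (-(D.a α x * hessian φ x).trace - inner ℝ (D.b α x) (gradient φ x) +
        D.c α x * φ x - D.f α x) - D.blendTerm θ h α x (φ x)
          (shift (truncInterp (h ^ q) M (κ (h ^ q)) φ) x) = R - θ * D.c α x * (h * (L + R)) := by
      rw [inner_gradient_eq, Coeffs.blendTerm, ← hAvg, hR, hLdef]
      field_simp
      ring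
    rw [e]
    have hc : |θ * D.c α x * (h * (L + R))| ≤
        θ * K * (h * (P * K ^ 2 * M₂ + K * M₁ + C₃ * (m * M₂ + h * M₄))) := by
      rw [abs_mul, abs_mul, abs_mul, abs_of_nonneg hθ.1, abs_of_pos hh0]
      have e1 := hD.abs_c_le α x
      have e2 := (abs_add_le L R).trans (add_le_add hLα hRle)
      have := hθ.1
      gcongr
    refine (abs_sub _ _).trans ((add_le_add hRle hc).trans ?_)
    have e5 : θ * K * (h * (P * K ^ 2 * M₂ + K * M₁ + C₃ * (m * M₂ + h * M₄))) =
        θ * (K * (P * K ^ 2) * (h * M₂)) + K * K * (θ * (h * M₁)) +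
        θ * (C₃ * (K * h) * (m * M₂ + h * M₄)) := by ring
    have e6 : θ * (K * (P * K ^ 2) * (h * M₂)) ≤ K * (P * K ^ 2) * (C₀ * m * M₂) :=
      (mul_le_of_le_one_left (by positivity) hθ.2).trans (by gcongr)
    have e7 : θ * (C₃ * (K * h) * (m * M₂ + h * M₄)) ≤ C₃ * (K * h₀) * (m * M₂ + h * M₄) :=
      (mul_le_of_le_one_left (by positivity) hθ.2).trans (by have := hh.2; gcongr)
    have p1 : 0 ≤ (C₃ * (1 + K * h₀) + K * (P * K ^ 2) * C₀ + 1) * (θ * (h * M₁)) := by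
      have := hθ.1
      positivity
    have p2 : 0 ≤ K * (P * K ^ 2) * C₀ * (h * M₄) := by positivity
    have p3 : 0 ≤ (K * K + 1) * (m * M₂ + h * M₄) := by positivity
    rw [e5]
    linarith
  -- The order is swapped so that boundedness is checked for the family defining `D.F`, where it
  -- follows from `hL`.
  rw [abs_sub_comm]
  refine abs_ciSup_sub_le ?_ fun α => by rw [abs_sub_comm]; exact hterm α
  refine ⟨P * K ^ 2 * M₂ + K * M₁ + K * |φ x| + K, ?_⟩
  rintro _ ⟨α, rfl⟩
  have b1 := neg_le_abs ((D.a α x * hessian φ x).trace + fderiv ℝ φ x (D.b α x))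
  have b2 : D.c α x * φ x ≤ K * |φ x| := (le_abs_self _).trans (by
    rw [abs_mul]
    exact mul_le_mul_of_nonneg_right (hD.abs_c_le α x) (abs_nonneg _))
  have b3 := (neg_le_abs _).trans (hD.abs_f_le α x)
  dsimp only
  rw [inner_gradient_eq]
  linarith [hL α]

/-- Consistency with the derivatives of orders `2` and `4`. -/
theorem consistent_blendScheme_zero [Nonempty A] (hD : D.Bounds lam K) (hP : 1 ≤ P) (M : ℕ)
    (κ : ℝ → E N → Fin N → ℤ) (hκ : ∀ δ > 0, IsMeshSelection δ (κ δ)) {k : ℕ → ℝ}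
    (hk2 : k 2 = min (2 * q - 1) 1) (hk4 : k 4 = 1) {h₀ : ℝ} (hh₀ : 0 < h₀) :
    Consistent D.F (Ioc 0 h₀) {2, 4} k (D.blendScheme 0 M q κ) := by
  obtain ⟨C, hC, H⟩ := exists_abs_F_sub_blendScheme_le hD hP M q κ hκ (θ := 0) (by simp) hh₀
  refine ⟨C, fun h hh x φ hφ => enorm_le_ofReal_mul_sum hC
    (fun i _ => Real.rpow_pos_of_pos hh.1 _) fun hs => ?_⟩
  -- The first-derivative bound is the norm at `x` itself, as its supremum may be infinite; the
  -- weight `θ = 0` removes it.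
  have := H h hh x φ hφ _ _ _ le_rfl (norm_le_toReal_supNorm (hs 2 (by simp)))
    (norm_le_toReal_supNorm (hs 4 (by simp)))
  rw [Finset.sum_pair (by norm_num), hk2, hk4, Real.rpow_one]
  simpa using this

/-- Consistency with the derivatives of orders `1`, `2` and `4`. -/
theorem consistent_blendScheme_one [Nonempty A] (hD : D.Bounds lam K) (hP : 1 ≤ P) (M : ℕ)
    (κ : ℝ → E N → Fin N → ℤ) (hκ : ∀ δ > 0, IsMeshSelection δ (κ δ)) {k : ℕ → ℝ}
    (hk1 : k 1 = 1) (hk2 : k 2 = min (2 * q - 1) 1) (hk4 : k 4 = 1) {h₀ : ℝ} (hh₀ : 0 < h₀) :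
    Consistent D.F (Ioc 0 h₀) {1, 2, 4} k (D.blendScheme 1 M q κ) := by
  obtain ⟨C, hC, H⟩ := exists_abs_F_sub_blendScheme_le hD hP M q κ hκ (θ := 1) (by simp) hh₀
  refine ⟨C, fun h hh x φ hφ => enorm_le_ofReal_mul_sum hC
    (fun i _ => Real.rpow_pos_of_pos hh.1 _) fun hs => ?_⟩
  have := H h hh x φ hφ _ _ _ (norm_le_toReal_supNorm (hs 1 (by simp)) x)
    (norm_le_toReal_supNorm (hs 2 (by simp))) (norm_le_toReal_supNorm (hs 4 (by simp)))
  rw [Finset.sum_insert (by norm_num), Finset.sum_pair (by norm_num), hk1, hk2, hk4,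
    Real.rpow_one]
  rwa [one_mul] at this

end Consistency

end HJB

/-! ### Both schemes as endpoints of the family -/

theorem mainTheorem6 {A : Type*} [MetricSpace A] [CompactSpace A] [Nonempty A]
    (N P M : ℕ) (hN : 1 ≤ N) (hP : 1 ≤ P) (hM : 2 ≤ M) (q lam K : ℝ)
    (D : HJB.Coeffs A N P) (hcont : D.IsContinuous) (hD : D.Bounds lam K)
    (κ : ℝ → HJB.E N → Fin N → ℤ) (hκ : ∀ δ > 0, HJB.IsMeshSelection δ (κ δ))
    (k : ℕ → ℝ) (hk1 : k 1 = 1) (hk2 : k 2 = min (2 * q - 1) 1) (hk4 : k 4 = 1) :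
    -- the scheme with zero-order term `c t`
    ((∃ K₁, HJB.EpsMonotone (Ioi 0) (q - 1) K₁ (D.scheme M q κ)) ∧
      HJB.Regular (Ioi 0) (fun h => HJB.grid N (h ^ q) M) (D.scheme M q κ) ∧
      (∀ h > 0, ∀ φ : HJB.E N → ℝ, HJB.MemCb φ →
        (N = 1 ∨ Continuous (HJB.truncInterp (h ^ q) M (κ (h ^ q)) φ)) →
        Continuous fun x => D.scheme M q κ h x (φ x) φ) ∧
      (∀ h₀ > 0, HJB.Consistent D.F (Ioc 0 h₀) {2, 4} k (D.scheme M q κ))) ∧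
    -- the scheme with discount factor `1 - h c`
    ((∃ K₁, HJB.EpsMonotone {h | 0 < h ∧ ∀ α x, h * D.c α x ≤ 1} (q - 1) K₁
        (D.schemeDisc M q κ)) ∧
      HJB.Regular (Ioi 0) (fun h => HJB.grid N (h ^ q) M) (D.schemeDisc M q κ) ∧
      (∀ h > 0, ∀ φ : HJB.E N → ℝ, HJB.MemCb φ →
        (N = 1 ∨ Continuous (HJB.truncInterp (h ^ q) M (κ (h ^ q)) φ)) →
        Continuous fun x => D.schemeDisc M q κ h x (φ x) φ) ∧
      (∀ h₀ > 0, HJB.Consistent D.F (Ioc 0 h₀) {1, 2, 4} k (D.schemeDisc M q κ))) := by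
  have h0 : (0 : ℝ) ∈ Icc (0 : ℝ) 1 := by simp
  have h1 : (1 : ℝ) ∈ Icc (0 : ℝ) 1 := by simp
  have hT : ∀ h > 0, ∀ φ : HJB.E N → ℝ,
      (N = 1 ∨ Continuous (HJB.truncInterp (h ^ q) M (κ (h ^ q)) φ)) →
      Continuous (HJB.truncInterp (h ^ q) M (κ (h ^ q)) φ) := by
    rintro h hh φ (hN1 | hc)
    · exact HJB.continuous_truncInterp_of_eq_one hN1 (Real.rpow_pos_of_pos hh q)
        (hκ _ (Real.rpow_pos_of_pos hh q)) φ
    · exact hc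
  rw [HJB.scheme_eq_blendScheme, HJB.schemeDisc_eq_blendScheme]
  -- For `θ = 0` the restriction on `h` reads `0 ≤ 1`; for `θ = 1` it is the condition defining the
  -- admissible set of `h`.
  refine ⟨⟨⟨√N, HJB.epsMonotone_blendScheme hD hP h0 κ fun h hh => ⟨hh, by simp⟩⟩,
      HJB.regular_blendScheme hD hP h0 κ,
      fun h hh φ hφ hc => HJB.continuous_blendScheme hcont hD hP h0 κ hh hφ (hT h hh φ hc),
      fun h₀ hh₀ => HJB.consistent_blendScheme_zero hD hP M κ hκ hk2 hk4 hh₀⟩,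
    ⟨⟨√N, HJB.epsMonotone_blendScheme hD hP h1 κ fun h hh => ⟨hh.1, by simpa using hh.2⟩⟩,
      HJB.regular_blendScheme hD hP h1 κ,
      fun h hh φ hφ hc => HJB.continuous_blendScheme hcont hD hP h1 κ hh hφ (hT h hh φ hc),
      fun h₀ hh₀ => HJB.consistent_blendScheme_one hD hP M κ hκ hk1 hk2 hk4 hh₀⟩⟩
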